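/- **Setting.** Let $n\ge 0$ and $\pi\in S_n$. A permutation is *Grassmannian* if it has at most one descent; $\pi$ is *inverse-Grassmannian* if $\pi^{-1}$ is Grassmannian. Rows are numbered from top to bottom, columns from left to right. A *bumpless pipe dream* (BPD) of size $n$ is a tiling of the $n\times n$ grid by six tiles (blank, cross, horizontal, vertical, an elbow joining the south and east edges, an elbow joining the west and north edges) that forms $n$ pipes travelling from the south border to the east border. Label the pipes $1,\dots,n$ from left to right on the south border; the *permutation* of a BPD lists the labels on the east border from top to bottom, where a cross-tile at which two pipes would cross again after having already crossed is read as a bump. $\mathrm{BPD}(\pi)$ is the set of all BPDs with permutation $\pi$. The *weight* of a BPD is $\prod x_i$ over its blank tiles $(i,j)$. The *Rothe BPD* of $\pi$ has south-east elbows exactly at the squares $(i,\pi(i))$ and no west-north elbows. A *simple droop* in a $2\times 2$ square pushes a pipe with a south-east elbow in the NW corner into the SE corner, which must be blank and becomes a west-north elbow, and makes the NW corner blank; the rest of the tiling outside the square is unchanged. The poset $\mathrm{droop}(\pi)$ consists of the BPDs obtained from the Rothe BPD of $\pi$ by simple droops, where $D\le D'$ if $D'$ is obtained from $D$ by a sequence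 of simple droops. A *pipe dream* of size $n$ is a tiling of the $n\times n$ grid by cross-tiles and elbow-tiles (joining north with west and east with south), with only elbow-tiles on or below the main antidiagonal. Its pipes are labelled $1,\dots,n$ from left to right on the north border and exit on the west border; it is *reduced* if no two pipes cross twice, and its *permutation* then lists the labels on the west border from top to bottom. $\mathrm{PD}^{red}(\pi)$ is the set of reduced pipe dreams with permutation $\pi$. The *weight* is $\prod x_i$ over the cross-tiles $(i,j)$. The *bottom pipe dream* of $\pi$ has in row $i$ cross-tiles exactly in the first $\#\{k>i:\pi(k)<\pi(i)\}$ columns. A *simple slide* moves a cross-tile from the SW corner to the NE corner of a $2\times2$ square whose other three tiles are elbow-tiles. The poset $\mathrm{slide}(\pi)$ consists of the pipe dreams obtained from the bottom pipe dream of $\pi$ by simple slides, where $P\le P'$ if $P'$ is obtained from $P$ by a sequence of simple slides. **Theorem.** Let $\pi\in S_n$ be inverse-Grassmannian. Then the elements of $\mathrm{droop}(\pi)$ are exactly those of $\mathrm{BPD}(\pi)$, the elements of $\mathrm{slide}(\pi)$ are exactly those of $\mathrm{PD}^{red}(\pi)$, the Rothe BPD of $\pi$ is in $\mathrm{BPD}(\pi)$,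 and the bottom pipe dream of $\pi$ is the unique element of $\mathrm{PD}^{red}(\pi)$ with left-justified cross-tiles. There is a bijection $\Phi:\mathrm{BPD}(\pi)\to\mathrm{PD}^{red}(\pi)$ such that: 1. $\Phi$ preserves the weight; 2. $\Phi$ is an isomorphism of posets $\mathrm{droop}(\pi)\cong\mathrm{slide}(\pi)$, and $D'$ arises from $D$ by one simple droop if and only if $\Phi(D')$ arises from $\Phi(D)$ by one simple slide; 3. $\Phi$ sends the Rothe BPD of $\pi$ to the bottom pipe dream of $\pi$, and the latter arises from the former by left-justifying the blank tiles in each row and turning them into cross-tiles; 4. explicitly, if $\pi^{-1}$ has a descent, say $\pi^{-1}(c+1)<\pi^{-1}(c)$, then for each $D\in\mathrm{BPD}(\pi)$ the cross-tiles of $\Phi(D)$ are exactly the squares $(i,c+1-k)$ such that $(i,k)$ is a blank tile of $D$ and $1\le k\le c$. (If $\pi^{-1}$ has no descent, then $\pi$ is the identity, and both sets consist of one element, without blank tiles or cross-tiles.) -/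

import Mathlib

/-!
Rows are numbered from top to bottom and columns from left to right, starting with `0`.
The permutation `π` has one-line notation `π 0, π 1, …`.
-/

namespace PipeDreams

/-! ### Grassmannian permutations -/

/-- The (positions of) descents of `σ`: those `i` with `σ (i + 1) < σ i`. -/
def descents {n : ℕ} (σ : Equiv.Perm (Fin n)) : Set (Fin n) :=
  {i | ∃ h : (i : ℕ) + 1 < n, σ ⟨(i : ℕ) + 1, h⟩ < σ i}

/-- A permutation is Grassmannian if it has at most one descent. -/
def IsGrassmannian {n : ℕ} (σ : Equiv.Perm (Fin n)) : Prop :=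
  (descents σ).Subsingleton

/-- A permutation is inverse-Grassmannian if its inverse is Grassmannian. -/
def IsInverseGrassmannian {n : ℕ} (π : Equiv.Perm (Fin n)) : Prop :=
  IsGrassmannian π⁻¹

/-! ### Bumpless pipe dreams -/

/-- The six tiles of a bumpless pipe dream. `rElbow` joins the south edge to the east edge of its
square and `jElbow` joins the west edge to the north edge. -/
inductive BTile
  | blank
  | cross
  | horiz
  | vert
  | rElbow
  | jElbow
deriving DecidableEq

namespace BTile

/-- A pipe meets the north edge of the tile. -/
def north : BTile → Bool
  | cross | vert | jElbow => true
  | _ => false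

/-- A pipe meets the south edge of the tile. -/
def south : BTile → Bool
  | cross | vert | rElbow => true
  | _ => false

/-- A pipe meets the east edge of the tile. -/
def east : BTile → Bool
  | cross | horiz | rElbow => true
  | _ => false

/-- A pipe meets the west edge of the tile. -/
def west : BTile → Bool
  | cross | horiz | jElbow => true
  | _ => false

end BTile

/-- A bumpless pipe dream of size `n`: a tiling of the `n × n` grid in which the pipes fit together
along the inner edges, a pipe enters through every edge of the south border and a pipe leaves
through every edge of the east border, and no pipe meets the north and west borders. -/
@[ext] structure BPD (n : ℕ) where
  /-- the tile in row `i` and column `j` -/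
  tile : Fin n → Fin n → BTile
  fit_horizontal : ∀ (i j j' : Fin n), (j' : ℕ) = j + 1 → (tile i j).east = (tile i j').west
  fit_vertical : ∀ (i i' j : Fin n), (i' : ℕ) = i + 1 → (tile i j).south = (tile i' j).north
  border_north : ∀ (i j : Fin n), (i : ℕ) = 0 → (tile i j).north = false
  border_west : ∀ (i j : Fin n), (j : ℕ) = 0 → (tile i j).west = false
  border_south : ∀ (i j : Fin n), (i : ℕ) + 1 = n → (tile i j).south = true
  border_east : ∀ (i j : Fin n), (j : ℕ) + 1 = n → (tile i j).east = true

namespace BPD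

variable {n : ℕ}

/-- The tile at a pair of natural numbers; `blank` outside the grid. -/
def tileAt (D : BPD n) (i j : ℕ) : BTile :=
  if h : i < n ∧ j < n then D.tile ⟨i, h.1⟩ ⟨j, h.2⟩ else .blank

/-- The pipes are labelled `0, …, n - 1` from left to right on the south border and are followed
towards north and east; `D.out i j` is the pair of the labels of the pipes that leave the square
`(i, j)` through its north edge and through its east edge (with the value `0` at an edge which no
pipe meets). At a cross-tile, the pipe entering from the west and the pipe entering from the south
have not crossed before exactly if the west label `w` is smaller than the south label `s`; then they
cross. If they have crossed before (`s < w`), then the tile counts as a bump: the pipe from the west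
leaves to the north and the pipe from the south leaves to the east. In both cases
the larger label leaves to the north and the smaller one to the east. -/
def out (D : BPD n) (i j : ℕ) : ℕ × ℕ :=
  let s : ℕ := if i + 1 < n then (out D (i + 1) j).1 else j
  let w : ℕ := if 0 < j then (out D i (j - 1)).2 else 0
  match D.tileAt i j with
  | .blank => (0, 0)
  | .cross => (max w s, min w s)
  | .horiz => (0, w)
  | .vert => (s, 0)
  | .rElbow => (0, s)
  | .jElbow => (w, 0)
termination_by (n - i) + j
decreasing_by all_goals omega

/-- `D` has permutation `π` if the labels of the pipes on the east border, read from top to bottom,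
are `π 0, π 1, …`. -/
def HasPerm (D : BPD n) (π : Equiv.Perm (Fin n)) : Prop :=
  ∀ i : Fin n, (D.out i (n - 1)).2 = π i

/-- The set of (positions of) blank tiles. -/
def blanks (D : BPD n) : Finset (Fin n × Fin n) :=
  Finset.univ.filter fun p => D.tile p.1 p.2 = .blank

/-- The weight: the product of the variables `x_i` over all blank tiles `(i, j)`. -/
noncomputable def weight (D : BPD n) : MvPolynomial (Fin n) ℤ :=
  ∏ p ∈ D.blanks, MvPolynomial.X p.1

/-- `D'` arises from `D` by a simple droop in the `2 × 2` square with rows `i`, `i'` and columns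
`j`, `j'`: the pipe which has an elbow in the NW corner of that square is pushed into the SE corner,
which was blank, and the NW corner becomes blank. The pipe enters the square either from the south
or from the west through the SW tile, and leaves it either to the east or to the north through the
NE tile. -/
def DroopStep (D D' : BPD n) : Prop :=
  ∃ i i' j j' : Fin n, (i' : ℕ) = i + 1 ∧ (j' : ℕ) = j + 1 ∧
    D.tile i j = .rElbow ∧ D'.tile i j = .blank ∧
    D.tile i' j' = .blank ∧ D'.tile i' j' = .jElbow ∧
    ((D.tile i j' = .horiz ∧ D'.tile i j' = .rElbow) ∨
      (D.tile i j' = .jElbow ∧ D'.tile i j' = .vert)) ∧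
    ((D.tile i' j = .vert ∧ D'.tile i' j = .rElbow) ∨
      (D.tile i' j = .jElbow ∧ D'.tile i' j = .horiz)) ∧
    ∀ a b : Fin n, ¬ ((a = i ∨ a = i') ∧ (b = j ∨ b = j')) → D'.tile a b = D.tile a b

/-- A statistic that decreases under simple droops (used for antisymmetry only). -/
def rank (D : BPD n) : ℕ := ∑ p ∈ D.blanks, (p.1 : ℕ)

theorem DroopStep.rank_lt {D D' : BPD n} (h : DroopStep D D') : D'.rank < D.rank := by
  obtain ⟨i, i', j, j', hi, hj, h1, h2, h3, h4, h5, h6, h7⟩ := h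
  have hne : i ≠ i' := fun h => by subst h; omega
  have hne' : j ≠ j' := fun h => by subst h; omega
  have hb : D'.blanks = insert (i, j) (D.blanks.erase (i', j')) := by
    ext ⟨a, b⟩
    simp only [blanks, Finset.mem_filter, Finset.mem_univ, true_and, Finset.mem_insert,
      Finset.mem_erase, Prod.mk.injEq, ne_eq]
    by_cases hab : (a = i ∨ a = i') ∧ (b = j ∨ b = j')
    · obtain ⟨rfl | rfl, rfl | rfl⟩ := hab
      · simp [h2]
      · rcases h5 with h5 | h5 <;> simp [h5, hne'.symm]
      · rcases h6 with h6 | h6 <;> simp [h6, hne.symm]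
      · simp [h4, hne.symm]
    · rw [h7 a b hab]
      have e1 : ¬ (a = i ∧ b = j) := fun h => hab ⟨Or.inl h.1, Or.inl h.2⟩
      have e2 : ¬ (a = i' ∧ b = j') := fun h => hab ⟨Or.inr h.1, Or.inr h.2⟩
      simp [e1, e2]
  have hm : (i', j') ∈ D.blanks := by simp [blanks, h3]
  have hn : (i, j) ∉ D.blanks.erase (i', j') := by simp [blanks, h1]
  unfold rank
  rw [hb, Finset.sum_insert hn, ← Finset.add_sum_erase _ _ hm]
  simp only
  omega

/-- The order on bumpless pipe dreams: `D ≤ D'` if `D'` arises from `D` by a sequence of simple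
droops. -/
instance : PartialOrder (BPD n) where
  le := Relation.ReflTransGen DroopStep
  le_refl _ := Relation.ReflTransGen.refl
  le_trans _ _ _ := Relation.ReflTransGen.trans
  le_antisymm := by
    have key : ∀ D D' : BPD n, Relation.ReflTransGen DroopStep D D' →
        D = D' ∨ D'.rank < D.rank := by
      intro D D' h
      induction h with
      | refl => exact Or.inl rfl
      | tail _ h ih =>
        rcases ih with rfl | ih
        · exact Or.inr h.rank_lt
        · exact Or.inr (h.rank_lt.trans ih)
    intro D D' h h'
    rcases key _ _ h with e | e
    · exact e
    · rcases key _ _ h' with e' | e'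
      · exact e'.symm
      · omega

end BPD

variable {n : ℕ}

/-- The tiles of the Rothe diagram of `π`: an `rElbow` at each `(i, π i)`, from which a ray runs to
the east and a ray runs to the south. -/
def rotheTile (π : Equiv.Perm (Fin n)) (i j : Fin n) : BTile :=
  if π i = j then .rElbow
  else if π i < j then (if π⁻¹ j < i then .cross else .horiz)
  else (if π⁻¹ j < i then .vert else .blank)

theorem rotheTile_east (π : Equiv.Perm (Fin n)) (i j : Fin n) :
    (rotheTile π i j).east = decide (π i ≤ j) := by
  unfold rotheTile
  split_ifs with h1 h2 h3 h4
  · simp [BTile.east, h1]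
  · simp [BTile.east, h2.le]
  · simp [BTile.east, h2.le]
  · have : ¬ π i ≤ j := fun h => h2 (lt_of_le_of_ne h h1)
    simp [BTile.east, this]
  · have : ¬ π i ≤ j := fun h => h2 (lt_of_le_of_ne h h1)
    simp [BTile.east, this]

theorem rotheTile_west (π : Equiv.Perm (Fin n)) (i j : Fin n) :
    (rotheTile π i j).west = decide (π i < j) := by
  unfold rotheTile
  split_ifs with h1 h2 h3 h4 <;> simp_all [BTile.west]

theorem rotheTile_north (π : Equiv.Perm (Fin n)) (i j : Fin n) :
    (rotheTile π i j).north = decide (π⁻¹ j < i) := by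
  unfold rotheTile
  split_ifs with h1 h2 h3 h4
  · subst h1; simp [BTile.north]
  all_goals simp_all [BTile.north]

theorem rotheTile_south (π : Equiv.Perm (Fin n)) (i j : Fin n) :
    (rotheTile π i j).south = decide (π⁻¹ j ≤ i) := by
  have key : π i ≠ j → (π⁻¹ j ≤ i ↔ π⁻¹ j < i) := fun h =>
    ⟨fun h' => lt_of_le_of_ne h' fun e => h (by rw [← e]; simp), le_of_lt⟩
  unfold rotheTile
  split_ifs with h1 h2 h3 h4
  · subst h1; simp [BTile.south]
  all_goals simp only [key h1]; simp_all [BTile.south]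

/-- The Rothe bumpless pipe dream of `π`. -/
def rotheBPD (π : Equiv.Perm (Fin n)) : BPD n where
  tile := rotheTile π
  fit_horizontal i j j' h := by
    rw [rotheTile_east, rotheTile_west, decide_eq_decide, Fin.le_def, Fin.lt_def]; omega
  fit_vertical i i' j h := by
    rw [rotheTile_south, rotheTile_north, decide_eq_decide, Fin.le_def, Fin.lt_def]; omega
  border_north i j h := by
    rw [rotheTile_north, decide_eq_false_iff_not, Fin.lt_def]; omega
  border_west i j h := by
    rw [rotheTile_west, decide_eq_false_iff_not, Fin.lt_def]; omega
  border_south i j h := by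
    rw [rotheTile_south, decide_eq_true_iff, Fin.le_def]; omega
  border_east i j h := by
    rw [rotheTile_east, decide_eq_true_iff, Fin.le_def]; omega

/-- `BPD(π)`: all bumpless pipe dreams with permutation `π`. -/
def bpdSet (π : Equiv.Perm (Fin n)) : Set (BPD n) := {D | D.HasPerm π}

/-- `droop(π)`: everything that is obtained from the Rothe bumpless pipe dream of `π` by simple
droops, a poset with the order of `BPD n`. -/
def droop (π : Equiv.Perm (Fin n)) : Set (BPD n) := {D | rotheBPD π ≤ D}

/-! ### Pipe dreams -/

/-- The two tiles of a pipe dream. `elbow` joins the north edge to the west edge and the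
east edge to the south edge of its square. -/
inductive PTile
  | cross
  | elbow
deriving DecidableEq

/-- A pipe dream of size `n`: a tiling of the `n × n` grid by cross-tiles and elbow-tiles, all of
whose squares on or below the main antidiagonal hold elbow-tiles. -/
@[ext] structure PD (n : ℕ) where
  /-- the tile in row `i` and column `j` -/
  tile : Fin n → Fin n → PTile
  elbow_below : ∀ i j : Fin n, n ≤ (i : ℕ) + j + 1 → tile i j = .elbow

namespace PD

variable {n : ℕ}

/-- The set of (positions of) cross-tiles. -/
def crosses (P : PD n) : Finset (Fin n × Fin n) :=
  Finset.univ.filter fun p => P.tile p.1 p.2 = .cross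

/-- The tile at a pair of natural numbers; `elbow` outside the grid. -/
def tileAt (P : PD n) (i j : ℕ) : PTile :=
  if h : i < n ∧ j < n then P.tile ⟨i, h.1⟩ ⟨j, h.2⟩ else .elbow

theorem lt_of_tileAt_eq_cross {P : PD n} {i j : ℕ} (h : P.tileAt i j = .cross) : j < n := by
  unfold tileAt at h
  split_ifs at h with h'
  exact h'.2

mutual

/-- The pipes are labelled `0, …, n - 1` from left to right on the north border and are followed to
the west border. `P.vLabel i j` is the label of the pipe that meets the upper edge of the square
`(i, j)`. (Only squares on or above the main antidiagonal matter.) -/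
def vLabel (P : PD n) (i j : ℕ) : ℕ :=
  match i with
  | 0 => j
  | i' + 1 => if P.tileAt i' j = .cross then vLabel P i' j else hLabel P i' (j + 1)
termination_by (i, 0, 0)
decreasing_by all_goals (simp_wf; simp [Prod.lex_def])

/-- `P.hLabel i j` is the label of the pipe that meets the left edge of the square `(i, j)`. -/
def hLabel (P : PD n) (i j : ℕ) : ℕ :=
  if h : P.tileAt i j = .cross then hLabel P i (j + 1) else vLabel P i j
termination_by (i, n - j, 1)
decreasing_by
  · have := lt_of_tileAt_eq_cross h
    exact Prod.Lex.right _ (Prod.Lex.left _ _ (by omega))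
  · rcases Nat.eq_zero_or_pos (n - j) with h0 | h0
    · rw [h0]
      exact Prod.Lex.right _ (Prod.Lex.right _ Nat.zero_lt_one)
    · exact Prod.Lex.right _ (Prod.Lex.left _ _ h0)

end

/-- The unordered pair of the two pipes that cross at the cross-tile `p`. -/
def crossingPair (P : PD n) (p : Fin n × Fin n) : Sym2 ℕ :=
  s(P.vLabel p.1 p.2, P.hLabel p.1 p.2)

/-- A pipe dream is reduced if no two pipes cross twice. -/
def IsReduced (P : PD n) : Prop :=
  ∀ p ∈ P.crosses, ∀ q ∈ P.crosses, P.crossingPair p = P.crossingPair q → p = q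

/-- `P` has permutation `π` if the labels of the pipes on the west border, read from top to bottom,
are `π 0, π 1, …`. -/
def HasPerm (P : PD n) (π : Equiv.Perm (Fin n)) : Prop :=
  ∀ i : Fin n, P.hLabel i 0 = π i

/-- The weight: the product of the variables `x_i` over all cross-tiles `(i, j)`. -/
noncomputable def weight (P : PD n) : MvPolynomial (Fin n) ℤ :=
  ∏ p ∈ P.crosses, MvPolynomial.X p.1

/-- `P'` arises from `P` by a simple slide in the `2 × 2` square with rows `i`, `i'` and columns
`j`, `j'`: its only cross-tile moves from the SW corner to the NE corner. -/
def SlideStep (P P' : PD n) : Prop :=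
  ∃ i i' j j' : Fin n, (i' : ℕ) = i + 1 ∧ (j' : ℕ) = j + 1 ∧
    P.tile i j = .elbow ∧ P.tile i j' = .elbow ∧
    P.tile i' j = .cross ∧ P.tile i' j' = .elbow ∧
    P'.tile i j = .elbow ∧ P'.tile i j' = .cross ∧
    P'.tile i' j = .elbow ∧ P'.tile i' j' = .elbow ∧
    ∀ a b : Fin n, ¬ ((a = i ∨ a = i') ∧ (b = j ∨ b = j')) → P'.tile a b = P.tile a b

/-- A statistic that decreases under simple slides (used for antisymmetry only). -/
def rank (P : PD n) : ℕ := ∑ p ∈ P.crosses, (p.1 : ℕ)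

theorem SlideStep.rank_lt {P P' : PD n} (h : SlideStep P P') : P'.rank < P.rank := by
  obtain ⟨i, i', j, j', hi, hj, h1, h2, h3, h4, h5, h6, h7, h8, h9⟩ := h
  have hne : i ≠ i' := fun h => by subst h; omega
  have hne' : j ≠ j' := fun h => by subst h; omega
  have hb : P'.crosses = insert (i, j') (P.crosses.erase (i', j)) := by
    ext ⟨a, b⟩
    simp only [crosses, Finset.mem_filter, Finset.mem_univ, true_and, Finset.mem_insert,
      Finset.mem_erase, Prod.mk.injEq, ne_eq]
    by_cases hab : (a = i ∨ a = i') ∧ (b = j ∨ b = j')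
    · obtain ⟨rfl | rfl, rfl | rfl⟩ := hab
      · simp [h1, h5, hne']
      · simp [h6]
      · simp [h7, hne.symm]
      · simp [h4, h8, hne.symm]
    · rw [h9 a b hab]
      have e1 : ¬ (a = i ∧ b = j') := fun h => hab ⟨Or.inl h.1, Or.inr h.2⟩
      have e2 : ¬ (a = i' ∧ b = j) := fun h => hab ⟨Or.inr h.1, Or.inl h.2⟩
      simp [e1, e2]
  have hm : (i', j) ∈ P.crosses := by simp [crosses, h3]
  have hn : (i, j') ∉ P.crosses.erase (i', j) := by simp [crosses, h2]
  unfold rank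
  rw [hb, Finset.sum_insert hn, ← Finset.add_sum_erase _ _ hm]
  simp only
  omega

/-- The order on pipe dreams: `P ≤ P'` if `P'` arises from `P` by a sequence of simple slides. -/
instance : PartialOrder (PD n) where
  le := Relation.ReflTransGen SlideStep
  le_refl _ := Relation.ReflTransGen.refl
  le_trans _ _ _ := Relation.ReflTransGen.trans
  le_antisymm := by
    have key : ∀ P P' : PD n, Relation.ReflTransGen SlideStep P P' →
        P = P' ∨ P'.rank < P.rank := by
      intro P P' h
      induction h with
      | refl => exact Or.inl rfl
      | tail _ h ih =>
        rcases ih with rfl | ih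
        · exact Or.inr h.rank_lt
        · exact Or.inr (h.rank_lt.trans ih)
    intro P P' h h'
    rcases key _ _ h with e | e
    · exact e
    · rcases key _ _ h' with e' | e'
      · exact e'.symm
      · omega

/-- All cross-tiles are left-justified: the squares to the left of a cross-tile in its row hold
cross-tiles. -/
def IsLeftJustified (P : PD n) : Prop :=
  ∀ i j k : Fin n, k ≤ j → P.tile i j = .cross → P.tile i k = .cross

end PD

/-- The `i`-th entry of the Lehmer code of `π`. -/
def lehmer (π : Equiv.Perm (Fin n)) (i : Fin n) : ℕ :=
  (Finset.univ.filter fun k : Fin n => i < k ∧ π k < π i).card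

theorem lehmer_add_lt (π : Equiv.Perm (Fin n)) (i : Fin n) : (i : ℕ) + lehmer π i + 1 ≤ n := by
  have h : lehmer π i ≤ (Finset.Ioi i).card :=
    Finset.card_le_card fun k hk => by
      simp only [Finset.mem_filter, Finset.mem_univ, true_and] at hk
      simpa using hk.1
  rw [Fin.card_Ioi] at h
  omega

/-- The bottom pipe dream of `π`: the left-justified pipe dream with permutation `π`, whose row `i`
starts with as many cross-tiles as the Lehmer code says. -/
def bottomPD (π : Equiv.Perm (Fin n)) : PD n where
  tile i j := if (j : ℕ) < lehmer π i then .cross else .elbow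
  elbow_below i j h := by
    have := lehmer_add_lt π i
    rw [if_neg (by omega)]

/-- `PD^red(π)`: all reduced pipe dreams with permutation `π`. -/
def pdRedSet (π : Equiv.Perm (Fin n)) : Set (PD n) := {P | P.IsReduced ∧ P.HasPerm π}

/-- `slide(π)`: everything that is obtained from the bottom pipe dream of `π` by simple slides, a
poset with the order of `PD n`. -/
def slide (π : Equiv.Perm (Fin n)) : Set (PD n) := {P | bottomPD π ≤ P}

/-- `P` is obtained from `D` by pushing the blank tiles of each row to the left border and turning
them into cross-tiles. -/
def IsLeftJustification (D : BPD n) (P : PD n) : Prop :=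
  ∀ i j : Fin n, P.tile i j = .cross ↔
    (j : ℕ) < (Finset.univ.filter fun k : Fin n => D.tile i k = .blank).card

end PipeDreams

/-!
Let `k` be such that `π⁻¹` increases on the values below `k` and on those from `k` on
(`IsSplit`; `k` is one more than the descent of `π⁻¹`, or `0` if there is none). Call a label *small*
if it is below `k`, and *large* otherwise. The key is to describe both `BPD(π)` and `PD^red(π)` by
local conditions that do not mention labels.

*Bumpless pipe dreams.* Pipes travel east, so large pipes stay in the columns from `k` on. Going
through these columns from right to left, one sees that each of them is a column of the Rothe
diagram (`BPD.Reads.step`). Behind column `k - 1`, there remain the small pipes, and they leave in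
increasing order. A cross-tile always sends the larger label to the north, which would destroy this
order for good, so there is no cross-tile in the columns before `k` (`BPD.no_cross_step`).
Conversely, these two properties force the permutation `π` (`BPD.hasPerm_iff_isGood`). They are
preserved by simple droops. A topmost `jElbow` can be pulled back by an inverse droop, and only the
Rothe diagram has no `jElbow`, so everything in `BPD(π)` is obtained by simple droops
(`BPD.IsGood.rotheBPD_le`).

*Pipe dreams.* Reading the tiles row by row, from right to left in each row, a pipe dream becomes a
word of adjacent transpositions (`PD.isSwapSequence_front`). It is reduced if and only if each
cross-tile creates an inversion (`PD.isReduced_iff`), and inversions are then never undone.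
Since `π` has no inversions among the small labels, nor among the large ones, each cross-tile is a
small pipe from the north crossing a large one. This condition and the colours of the pipes that
leave in each row characterize `PD^red(π)` (`PD.mem_pdRedSet_iff`).

*The bijection.* Reflect the columns before `k` by `j ↦ k - 1 - j`, and turn blank tiles into
cross-tiles. The other tiles correspond, too: a vertical edge of the bumpless pipe dream is met by a
pipe exactly if the pipe of the pipe dream at the reflected edge is small, and a horizontal edge
exactly if it is large (`BPD.IsGood.colours`). Under this dictionary, the five tiles other than the
cross-tile are the five colourings of a cross-tile or an elbow-tile that are allowed, whence the
bijection (`BPD.IsGood.eq_of_reflect_eq`, `PD.IsGood.exists_reflect_eq`). A square in which only the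
SE corner is blank admits a simple droop, since its edges determine the other tiles
(`BPD.IsGood.exists_droopAt`), so droops correspond to slides.
-/

namespace PipeDreams

namespace BPD

variable {n : ℕ} (D : BPD n)

/-! ### Edges and labels of a bumpless pipe dream -/

theorem tileAt_coe (i j : Fin n) : D.tileAt i j = D.tile i j := by
  simp [tileAt]

/-- Whether a pipe meets the vertical segment in row `i` between the columns `m - 1` and `m`. -/
def hEdge (i m : ℕ) : Bool := if 0 < m then (D.tileAt i (m - 1)).east else false

/-- Whether a pipe meets the horizontal segment in column `j` between the rows `m - 1` and `m`. -/
def vEdge (m j : ℕ) : Bool := if 0 < m then (D.tileAt (m - 1) j).south else false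

/-- The label at the vertical segment in row `i` between the columns `m - 1` and `m`; it is meaningful
only if a pipe meets this segment. -/
def hLab (i m : ℕ) : ℕ := if 0 < m then (D.out i (m - 1)).2 else 0

/-- The label at the horizontal segment in column `j` between the rows `m - 1` and `m`; it is
meaningful only if a pipe meets this segment. On the south border, the label is the column. -/
def vLab (m j : ℕ) : ℕ := if m < n then (D.out m j).1 else j

theorem hEdge_zero (i : ℕ) : D.hEdge i 0 = false := by simp [hEdge]

theorem vEdge_zero (j : ℕ) : D.vEdge 0 j = false := by simp [vEdge]

theorem east_eq (i j : ℕ) : (D.tileAt i j).east = D.hEdge i (j + 1) := by simp [hEdge]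

theorem south_eq (i j : ℕ) : (D.tileAt i j).south = D.vEdge (i + 1) j := by simp [vEdge]

theorem west_eq {i j : ℕ} (hi : i < n) (hj : j < n) : (D.tileAt i j).west = D.hEdge i j := by
  rcases j with _ | j
  · simpa [tileAt, hi, hj, hEdge] using D.border_west ⟨i, hi⟩ ⟨0, hj⟩ rfl
  · have hj' : j < n := by omega
    simpa [tileAt, hi, hj, hj', hEdge] using
      (D.fit_horizontal ⟨i, hi⟩ ⟨j, hj'⟩ ⟨j + 1, hj⟩ rfl).symm

theorem north_eq {i j : ℕ} (hi : i < n) (hj : j < n) : (D.tileAt i j).north = D.vEdge i j := by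
  rcases i with _ | i
  · simpa [tileAt, hi, hj, vEdge] using D.border_north ⟨0, hi⟩ ⟨j, hj⟩ rfl
  · have hi' : i < n := by omega
    simpa [tileAt, hi, hj, hi', vEdge] using
      (D.fit_vertical ⟨i, hi'⟩ ⟨i + 1, hi⟩ ⟨j, hj⟩ rfl).symm

theorem hEdge_last {i : ℕ} (hi : i < n) : D.hEdge i n = true := by
  obtain ⟨m, rfl⟩ : ∃ m, n = m + 1 := ⟨n - 1, by omega⟩
  simpa [tileAt, hi, hEdge] using D.border_east ⟨i, hi⟩ ⟨m, by omega⟩ rfl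

theorem vEdge_last {j : ℕ} (hj : j < n) : D.vEdge n j = true := by
  obtain ⟨m, rfl⟩ : ∃ m, n = m + 1 := ⟨n - 1, by omega⟩
  simpa [tileAt, hj, vEdge] using D.border_south ⟨m, by omega⟩ ⟨j, hj⟩ rfl

theorem vLab_last (j : ℕ) : D.vLab n j = j := by simp [vLab]

/-- The four edges of a tile and the labels that leave it to the north and to the east, for each of
the six tiles. -/
theorem local_cases {i j : ℕ} (hi : i < n) (hj : j < n) :
    (D.tileAt i j = .blank ∧ D.hEdge i j = false ∧ D.hEdge i (j + 1) = false ∧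
        D.vEdge i j = false ∧ D.vEdge (i + 1) j = false) ∨
      (D.tileAt i j = .cross ∧ D.hEdge i j = true ∧ D.hEdge i (j + 1) = true ∧
        D.vEdge i j = true ∧ D.vEdge (i + 1) j = true ∧
        D.vLab i j = max (D.hLab i j) (D.vLab (i + 1) j) ∧
        D.hLab i (j + 1) = min (D.hLab i j) (D.vLab (i + 1) j)) ∨
      (D.tileAt i j = .horiz ∧ D.hEdge i j = true ∧ D.hEdge i (j + 1) = true ∧
        D.vEdge i j = false ∧ D.vEdge (i + 1) j = false ∧
        D.hLab i (j + 1) = D.hLab i j) ∨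
      (D.tileAt i j = .vert ∧ D.hEdge i j = false ∧ D.hEdge i (j + 1) = false ∧
        D.vEdge i j = true ∧ D.vEdge (i + 1) j = true ∧
        D.vLab i j = D.vLab (i + 1) j) ∨
      (D.tileAt i j = .rElbow ∧ D.hEdge i j = false ∧ D.hEdge i (j + 1) = true ∧
        D.vEdge i j = false ∧ D.vEdge (i + 1) j = true ∧
        D.hLab i (j + 1) = D.vLab (i + 1) j) ∨
      (D.tileAt i j = .jElbow ∧ D.hEdge i j = true ∧ D.hEdge i (j + 1) = false ∧
        D.vEdge i j = true ∧ D.vEdge (i + 1) j = false ∧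
        D.vLab i j = D.hLab i j) := by
  rw [← D.west_eq hi hj, ← D.north_eq hi hj, ← D.east_eq, ← D.south_eq]
  have h1 : D.vLab i j = (D.out i j).1 := by simp [vLab, hi]
  have h2 : D.hLab i (j + 1) = (D.out i j).2 := by simp [hLab]
  have h3 : D.out i j = match D.tileAt i j with
    | .blank => (0, 0)
    | .cross => (max (D.hLab i j) (D.vLab (i + 1) j), min (D.hLab i j) (D.vLab (i + 1) j))
    | .horiz => (0, D.hLab i j)
    | .vert => (D.vLab (i + 1) j, 0)
    | .rElbow => (0, D.vLab (i + 1) j)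
    | .jElbow => (D.hLab i j, 0) := by
    rw [out]; rfl
  rw [h1, h2, h3]
  generalize D.tileAt i j = t
  cases t <;> simp [BTile.east, BTile.west, BTile.north, BTile.south]

/-- Two bumpless pipe dreams with the same edges are equal, because a tile is determined by the
edges that it meets. -/
theorem ext_of_edges {D D' : BPD n}
    (hh : ∀ i j, i < n → j < n → D.hEdge i (j + 1) = D'.hEdge i (j + 1))
    (hv : ∀ i j, i < n → j < n → D.vEdge (i + 1) j = D'.vEdge (i + 1) j) : D = D' := by
  ext i j : 3
  have e1 := hh i j i.2 j.2
  have e2 := hv i j i.2 j.2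
  have e3 : D.hEdge i j = D'.hEdge i j := by
    rcases h : (j : ℕ) with _ | m
    · simp [hEdge_zero]
    · exact hh i m i.2 (by omega)
  have e4 : D.vEdge i j = D'.vEdge i j := by
    rcases h : (i : ℕ) with _ | m
    · simp [vEdge_zero]
    · exact hv m j (by omega) j.2
  rw [← D.west_eq i.2 j.2, ← D'.west_eq i.2 j.2, tileAt_coe, tileAt_coe] at e3
  rw [← D.north_eq i.2 j.2, ← D'.north_eq i.2 j.2, tileAt_coe, tileAt_coe] at e4
  rw [← east_eq, ← east_eq, tileAt_coe, tileAt_coe] at e1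
  rw [← south_eq, ← south_eq, tileAt_coe, tileAt_coe] at e2
  revert e1 e2 e3 e4
  cases D.tile i j <;> cases D'.tile i j <;>
    simp [BTile.east, BTile.west, BTile.north, BTile.south]

/-- Pipes travel towards north and east, so a label is at most the index of its column. -/
theorem vLab_le_and_hLab_le (j : ℕ) (hj : j < n) :
    (∀ i ≤ n, D.vEdge i j = true → D.vLab i j ≤ j) ∧
      ∀ i < n, D.hEdge i (j + 1) = true → D.hLab i (j + 1) ≤ j := by
  induction j with
  | zero =>
    have key : ∀ i ≤ n, D.vEdge i 0 = true → D.vLab i 0 ≤ 0 := by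
      intro i hi
      induction hi using Nat.decreasingInduction with
      | self => simp [vLab_last]
      | of_succ i hi ih =>
        have := D.hEdge_zero i
        rcases D.local_cases hi hj with h | h | h | h | h | h <;> simp_all
    refine ⟨key, fun i hi => ?_⟩
    have h1 := key (i + 1) hi
    have := D.hEdge_zero i
    rcases D.local_cases hi hj with h | h | h | h | h | h <;> simp_all
  | succ j ih =>
    obtain ⟨-, ih⟩ := ih (by omega)
    have key : ∀ i ≤ n, D.vEdge i (j + 1) = true → D.vLab i (j + 1) ≤ j + 1 := by
      intro i hi
      induction hi using Nat.decreasingInduction with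
      | self => simp [vLab_last]
      | of_succ i hi ih' =>
        have := ih i hi
        have := D.local_cases hi hj
        grind
    refine ⟨key, fun i hi => ?_⟩
    have h1 := key (i + 1) hi
    have := ih i hi
    have := D.local_cases hi hj
    grind

theorem hLab_lt {i m : ℕ} (hi : i < n) (hm : m ≤ n) (h : D.hEdge i m = true) : D.hLab i m < m := by
  rcases m with _ | m
  · simp [hEdge_zero] at h
  · exact Nat.lt_succ_of_le ((D.vLab_le_and_hLab_le m hm).2 i hi h)

/-- The number of pipes that pass between the columns `m - 1` and `m` above row `i`. -/
def hCount (i m : ℕ) : ℕ := ∑ b ∈ Finset.range i, if D.hEdge b m = true then 1 else 0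

theorem hCount_succ (i m : ℕ) :
    D.hCount (i + 1) m = D.hCount i m + if D.hEdge i m = true then 1 else 0 :=
  Finset.sum_range_succ _ _

theorem hCount_zero_left (m : ℕ) : D.hCount 0 m = 0 := rfl

theorem hCount_zero_right (i : ℕ) : D.hCount i 0 = 0 := by simp [hCount, hEdge_zero]

/-- Conservation of pipes in the part of column `j` above row `i`. -/
theorem hCount_succ_right {i j : ℕ} (hi : i ≤ n) (hj : j < n) :
    D.hCount i (j + 1) = D.hCount i j + if D.vEdge i j = true then 1 else 0 := by
  induction i with
  | zero => simp [hCount_zero_left, vEdge_zero]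
  | succ i ih =>
    have ih := ih (by omega)
    rw [hCount_succ, hCount_succ, ih]
    rcases D.local_cases hi hj with h | h | h | h | h | h <;> simp_all

theorem hCount_height {m : ℕ} (hm : m ≤ n) : D.hCount n m = m := by
  induction m with
  | zero => exact D.hCount_zero_right n
  | succ m ih => rw [D.hCount_succ_right le_rfl hm, ih (by omega), D.vEdge_last hm]; simp

end BPD

end PipeDreams

namespace PipeDreams

variable {n : ℕ}

/-! ### Inverse-Grassmannian permutations -/

/-- The values of `π` below `k` occur in increasing order in its one-line notation, and so do the
values that are at least `k`; the bound `k ≤ n` keeps the columns before `k` inside the grid. -/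
structure IsSplit (π : Equiv.Perm (Fin n)) (k : ℕ) : Prop where
  le : k ≤ n
  lt : ∀ a b : Fin n, π a < π b → ((π b : ℕ) < k ∨ k ≤ (π a : ℕ)) → a < b

theorem isSplit_of_ascents {π : Equiv.Perm (Fin n)} {k : ℕ} (hk : k ≤ n)
    (h : ∀ (i : Fin n) (hi : (i : ℕ) + 1 < n), (i : ℕ) + 1 ≠ k →
      π⁻¹ i < π⁻¹ ⟨(i : ℕ) + 1, hi⟩) : IsSplit π k := by
  have key : ∀ (b : ℕ) (hb : b < n) (a : Fin n), (a : ℕ) < b → (b < k ∨ k ≤ a) →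
      π⁻¹ a < π⁻¹ ⟨b, hb⟩ := by
    intro b
    induction b with
    | zero => intro _ a ha; omega
    | succ b ih =>
      intro hb a ha hs
      have hstep := h ⟨b, by omega⟩ hb (by simp only; omega)
      rcases Nat.lt_succ_iff_lt_or_eq.1 ha with h1 | h1
      · exact (ih (by omega) a h1 (by omega)).trans hstep
      · have : a = ⟨b, by omega⟩ := Fin.ext h1
        rwa [this]
  refine ⟨hk, fun a b hab hs => ?_⟩
  simpa using key (π b) (π b).2 (π a) hab hs

theorem isSplit_of_mem_descents {π : Equiv.Perm (Fin n)} (hπ : IsInverseGrassmannian π) {c : Fin n}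
    (hc : c ∈ descents π⁻¹) : IsSplit π (c + 1) := by
  refine isSplit_of_ascents c.2 fun i hi hne => ?_
  by_contra hcon
  have hne' : π⁻¹ ⟨(i : ℕ) + 1, hi⟩ ≠ π⁻¹ i := by
    intro e
    have := congrArg Fin.val (π⁻¹.injective e)
    simp at this
  have : i ∈ descents π⁻¹ := ⟨hi, lt_of_le_of_ne (not_lt.1 hcon) hne'⟩
  exact hne (by rw [hπ this hc])

theorem exists_isSplit {π : Equiv.Perm (Fin n)} (hπ : IsInverseGrassmannian π) :
    ∃ k, IsSplit π k ∧ ∀ c ∈ descents π⁻¹, k = c + 1 := by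
  by_cases h : ∃ c, c ∈ descents π⁻¹
  · obtain ⟨c, hc⟩ := h
    exact ⟨c + 1, isSplit_of_mem_descents hπ hc, fun c' hc' => by rw [hπ hc hc']⟩
  · refine ⟨0, isSplit_of_ascents (Nat.zero_le n) fun i hi _ => ?_, fun c hc => (h ⟨c, hc⟩).elim⟩
    by_contra hcon
    refine h ⟨i, hi, lt_of_le_of_ne (not_lt.1 hcon) fun e => ?_⟩
    have := congrArg Fin.val (π⁻¹.injective e)
    simp at this

/-- The entries `π a` below `k` are counted off in order. -/
theorem IsSplit.card_small {π : Equiv.Perm (Fin n)} {k : ℕ} (hπ : IsSplit π k) (a : Fin n)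
    (ha : (π a : ℕ) < k) :
    (Finset.univ.filter fun b : Fin n => b < a ∧ (π b : ℕ) < k).card = π a := by
  have : (Finset.univ.filter fun b : Fin n => b < a ∧ (π b : ℕ) < k).map π.toEmbedding =
      Finset.Iio (π a) := by
    ext v
    simp only [Finset.mem_map, Finset.mem_filter, Finset.mem_univ, true_and, Finset.mem_Iio,
      Equiv.coe_toEmbedding]
    constructor
    · rintro ⟨b, ⟨hb, hbk⟩, rfl⟩
      by_contra hcon
      have hne : π a ≠ π b := fun e => hb.ne (π.injective e).symm
      exact hb.not_gt (hπ.lt a b (lt_of_le_of_ne (not_lt.1 hcon) hne) (Or.inl hbk))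
    · intro hv
      refine ⟨π⁻¹ v, ⟨hπ.lt _ _ (by simpa using hv) (Or.inl ha), ?_⟩, by simp⟩
      have : (v : ℕ) < π a := hv
      simp; omega
  have h2 := congrArg Finset.card this
  rwa [Finset.card_map, Fin.card_Iio] at h2

namespace BPD

variable {D : BPD n} {π : Equiv.Perm (Fin n)} {k : ℕ}

/-! ### The bumpless pipe dreams of a permutation -/

/-- A description of the elements of `BPD(π)` that does not mention labels: the columns from `k` on
are those of the Rothe bumpless pipe dream, and the columns before `k` hold no cross-tiles. -/
structure IsGood (D : BPD n) (π : Equiv.Perm (Fin n)) (k : ℕ) : Prop where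
  right : ∀ i j : Fin n, k ≤ (j : ℕ) → D.tile i j = rotheTile π i j
  left : ∀ i j : Fin n, (j : ℕ) < k → D.tile i j ≠ .cross

/-- Between the columns `m - 1` and `m`, there are exactly the pipes with a label below `m`, each
in the row in which it will reach the east border. -/
def Reads (D : BPD n) (π : Equiv.Perm (Fin n)) (m : ℕ) : Prop :=
  ∀ i : Fin n, (D.hEdge i m = true ↔ (π i : ℕ) < m) ∧ ((π i : ℕ) < m → D.hLab i m = π i)

theorem hasPerm_iff_reads : D.HasPerm π ↔ D.Reads π n := by
  constructor
  · intro h i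
    have hn : 0 < n := i.pos
    refine ⟨by simp [D.hEdge_last i.2], fun _ => ?_⟩
    simpa [hLab, hn] using h i
  · intro h i
    have hn : 0 < n := i.pos
    simpa [hLab, hn] using (h i).2 (π i).2

/-- If the pipes behind column `m ≥ k` are already in their final rows, then column `m` is the one
of the Rothe bumpless pipe dream: the pipe `m` has the largest label there, so it goes straight
north up to the row in which it has to end, and the descent structure of `π` forces all rows above
to be filled. -/
theorem Reads.step (hπ : IsSplit π k) {m : ℕ} (hm : m < n) (hkm : k ≤ m)
    (h : D.Reads π (m + 1)) :
    (∀ i : Fin n, D.tile i ⟨m, hm⟩ = rotheTile π i ⟨m, hm⟩) ∧ D.Reads π m := by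
  set r := π⁻¹ ⟨m, hm⟩ with hr
  have hrm : (π r : ℕ) = m := by simp [hr]
  have hne : ∀ i : Fin n, i ≠ r → (π i : ℕ) ≠ m := fun i hi e =>
    hi (π.injective (Fin.ext (by rw [e, hrm])))
  have below : ∀ i ≤ n, (r : ℕ) < i → D.vEdge i m = true ∧ D.vLab i m = m := by
    intro i hi
    induction hi using Nat.decreasingInduction with
    | self => exact fun _ => ⟨D.vEdge_last hm, D.vLab_last m⟩
    | of_succ i hi ih =>
      intro hri
      obtain ⟨h1, h2⟩ := ih (by omega)
      obtain ⟨h3, h4⟩ := h ⟨i, hi⟩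
      have h5 := hne ⟨i, hi⟩ (fun e => by simp [← e] at hri)
      have h6 := D.hLab_lt hi hm.le
      have := D.local_cases hi hm
      simp only at h3 h4
      grind
  have at_r : D.tileAt r m = .rElbow ∧ D.vEdge r m = false := by
    obtain ⟨h1, h2⟩ := below (r + 1) r.2 (by omega)
    obtain ⟨h3, h4⟩ := h r
    have h6 := D.hLab_lt r.2 hm.le
    have := D.local_cases r.2 hm
    grind
  have above_east : ∀ i : Fin n, i < r → (π i : ℕ) < m := by
    intro i hi
    have h5 := hne i hi.ne
    by_contra hcon
    have := hπ.lt r i (by rw [Fin.lt_def]; omega) (Or.inr (by omega))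
    exact absurd hi this.not_gt
  have above : ∀ i ≤ (r : ℕ), D.vEdge i m = false := by
    intro i hi
    induction hi using Nat.decreasingInduction with
    | self => exact at_r.2
    | of_succ i hi ih =>
      have hin : i < n := hi.trans r.2
      have h1 := above_east ⟨i, hin⟩ hi
      obtain ⟨h3, h4⟩ := h ⟨i, hin⟩
      have := D.local_cases hin hm
      simp only at h1 h3 h4
      grind
  constructor
  · intro i
    rw [← tileAt_coe, rotheTile, ← hr]
    obtain ⟨h3, h4⟩ := h i
    have hc := D.local_cases i.2 hm
    simp only [Fin.ext_iff, Fin.lt_def]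
    rcases lt_trichotomy (i : ℕ) r with hi | hi | hi
    · have h1 := above_east i hi
      have h2 := above i hi.le
      have h2' := above (i + 1) hi
      grind
    · have : i = r := Fin.ext hi
      subst this
      simp [hrm, at_r.1]
    · have h1 := below i i.2.le hi
      have h1' := below (i + 1) i.2 (by omega)
      have h5 := hne i (fun e => by simp [e] at hi)
      grind
  · intro i
    obtain ⟨h3, h4⟩ := h i
    have h6 := D.hLab_lt i.2 hm.le
    have hc := D.local_cases i.2 hm
    rcases lt_trichotomy (i : ℕ) r with hi | hi | hi
    · have h1 := above_east i hi
      have h2 := above i hi.le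
      have h2' := above (i + 1) hi
      grind
    · have : i = r := Fin.ext hi
      subst this
      grind
    · have h1 := below i i.2.le hi
      have h1' := below (i + 1) i.2 (by omega)
      have h5 := hne i (fun e => by simp [e] at hi)
      grind

/-- If the labels that leave column `j` increase from top to bottom, then column `j` holds no
cross-tile, since a cross-tile sends the larger label to the north; and the labels that enter it
increase, too. Increasing labels are expressed by saying that each label is the number of pipes
above it. -/
theorem no_cross_step {j : ℕ} (hj : j < n)
    (h : ∀ i < n, D.hEdge i (j + 1) = true → D.hLab i (j + 1) = D.hCount i (j + 1)) :
    (∀ i < n, D.tileAt i j ≠ .cross) ∧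
      ∀ i < n, D.hEdge i j = true → D.hLab i j = D.hCount i j := by
  have key : ∀ i ≤ n, D.vEdge i j = true → D.vLab i j = D.hCount i j := by
    intro i
    induction i with
    | zero => simp [vEdge_zero]
    | succ i ih =>
      intro hi
      have h1 := ih (by omega)
      have h2 := h i hi
      have h3 := D.hCount_succ_right (i := i) (by omega) hj
      have h4 := D.hCount_succ i j
      have := D.local_cases hi hj
      grind
  constructor
  · intro i hi hc
    have h1 := key i hi.le
    have h2 := h i hi
    have h3 := D.hCount_succ_right hi.le hj
    have := D.local_cases hi hj
    grind
  · intro i hi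
    have h1 := key i hi.le
    have h1' := key (i + 1) hi
    have h2 := h i hi
    have h3 := D.hCount_succ_right hi.le hj
    have := D.local_cases hi hj
    grind

/-- The number of pipes above row `a`, between the columns `k - 1` and `k`. -/
theorem hCount_of_edges (hπ : IsSplit π k)
    (h : ∀ i : Fin n, D.hEdge i k = true ↔ (π i : ℕ) < k) (a : Fin n) (ha : (π a : ℕ) < k) :
    D.hCount a k = π a := by
  rw [← hπ.card_small a ha, hCount, ← Finset.card_filter]
  symm
  refine Finset.card_bij (fun b _ => (b : ℕ)) ?_ (fun _ _ _ _ e => Fin.ext e) ?_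
  · intro b hb
    simp only [Finset.mem_filter, Finset.mem_univ, true_and] at hb
    exact Finset.mem_filter.2 ⟨Finset.mem_range.2 hb.1, (h b).2 hb.2⟩
  · intro b hb
    simp only [Finset.mem_filter, Finset.mem_range] at hb
    have hbn : b < n := hb.1.trans a.2
    exact ⟨⟨b, hbn⟩, Finset.mem_filter.2
      ⟨Finset.mem_univ _, Fin.lt_def.2 hb.1, (h ⟨b, hbn⟩).1 hb.2⟩, rfl⟩

theorem HasPerm.isGood (hπ : IsSplit π k) (h : D.HasPerm π) : D.IsGood π k := by
  have hreads : ∀ m ≤ n, k ≤ m → D.Reads π m := by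
    intro m hm
    induction hm using Nat.decreasingInduction with
    | self => exact fun _ => hasPerm_iff_reads.1 h
    | of_succ m hm ih => exact fun hk => ((ih (by omega)).step hπ hm hk).2
  have hk := hreads k hπ.le le_rfl
  have hcount : ∀ m ≤ k, ∀ i < n, D.hEdge i m = true → D.hLab i m = D.hCount i m := by
    intro m hm
    induction hm using Nat.decreasingInduction with
    | self =>
      intro i hi he
      have he' := (hk ⟨i, hi⟩).1.1 he
      have := hCount_of_edges hπ (fun i => (hk i).1) ⟨i, hi⟩ he'
      rw [show D.hCount i k = _ from this]
      exact (hk ⟨i, hi⟩).2 he'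
    | of_succ m hm ih => exact (no_cross_step (hm.trans_le hπ.le) ih).2
  constructor
  · intro i j hj
    exact ((hreads (j + 1) j.2 (by omega)).step hπ j.2 hj).1 i
  · intro i j hj
    rw [← tileAt_coe]
    exact (no_cross_step j.2 (hcount (j + 1) hj)).1 i i.2

theorem IsGood.hEdge_iff (hπ : IsSplit π k) (h : D.IsGood π k) (i : Fin n) :
    D.hEdge i k = true ↔ (π i : ℕ) < k := by
  rcases hπ.le.eq_or_lt with rfl | hk
  · simp [D.hEdge_last i.2]
  · rw [← D.west_eq i.2 hk]
    have := h.right i ⟨k, hk⟩ le_rfl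
    rw [show D.tileAt i k = D.tile i ⟨k, hk⟩ from D.tileAt_coe i ⟨k, hk⟩, this, rotheTile_west]
    simp [Fin.lt_def]

theorem IsGood.hasPerm (hπ : IsSplit π k) (h : D.IsGood π k) : D.HasPerm π := by
  have hcount : ∀ m ≤ k, ∀ i < n, D.hEdge i m = true → D.hLab i m = D.hCount i m := by
    intro m
    induction m with
    | zero => simp [hEdge_zero]
    | succ j ih =>
      intro hj
      have hjn : j < n := lt_of_lt_of_le hj hπ.le
      have ih := ih (by omega)
      have hcross : ∀ i < n, D.tileAt i j ≠ .cross := fun i hi => by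
        simpa [tileAt, hi, hjn] using h.left ⟨i, hi⟩ ⟨j, hjn⟩ hj
      have key : ∀ i ≤ n, D.vEdge i j = true → D.vLab i j = D.hCount i j := by
        intro i hi
        induction hi using Nat.decreasingInduction with
        | self => exact fun _ => by rw [vLab_last, D.hCount_height hjn.le]
        | of_succ i hi ih' =>
          have h1 := ih i hi
          have h4 := D.hCount_succ i j
          have := D.local_cases hi hjn
          have := hcross i hi
          grind
      intro i hi
      have h0 := key (i + 1) hi
      have h1 := ih i hi
      have h3 := D.hCount_succ_right hi.le hjn
      have h4 := D.hCount_succ i j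
      have := D.local_cases hi hjn
      have := hcross i hi
      grind
  have hreads : ∀ m, k ≤ m → m ≤ n → D.Reads π m := by
    intro m hm
    induction m, hm using Nat.le_induction with
    | base =>
      intro hk i
      have h1 := h.hEdge_iff hπ
      refine ⟨h1 i, fun hi => ?_⟩
      rw [hcount k le_rfl i i.2 ((h1 i).2 hi), hCount_of_edges hπ h1 i hi]
    | succ j hkj ih =>
      intro hjn
      have ih := ih (by omega)
      have htile : ∀ i : Fin n, D.tileAt i j = rotheTile π i ⟨j, hjn⟩ := fun i => by
        rw [← h.right i ⟨j, hjn⟩ hkj]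
        exact D.tileAt_coe i ⟨j, hjn⟩
      have htile' : ∀ i : Fin n, D.tileAt i j ≠ .jElbow := fun i => by
        rw [htile, rotheTile]; split_ifs <;> simp
      have key : ∀ i ≤ n, D.vEdge i j = true → D.vLab i j = j := by
        intro i hi
        induction hi using Nat.decreasingInduction with
        | self => exact fun _ => D.vLab_last j
        | of_succ i hi ih' =>
          have h1 := D.hLab_lt (m := j) hi (by omega)
          have := D.local_cases hi hjn
          have := htile' ⟨i, hi⟩
          simp only at this
          grind
      intro i
      have h0 := key (i + 1) i.2
      have h1 := D.hLab_lt (m := j) i.2 (by omega)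
      have h2 := ih i
      have h3 := rotheTile_east π i ⟨j, hjn⟩
      have h3' := rotheTile_west π i ⟨j, hjn⟩
      rw [← htile, D.east_eq] at h3
      rw [← htile, D.west_eq i.2 hjn] at h3'
      simp only [Fin.le_def, Fin.lt_def] at h3 h3'
      have := D.local_cases i.2 hjn
      have := htile' i
      grind
  exact hasPerm_iff_reads.2 (hreads n hπ.le le_rfl)

theorem hasPerm_iff_isGood (hπ : IsSplit π k) : D.HasPerm π ↔ D.IsGood π k :=
  ⟨fun h => h.isGood hπ, fun h => h.hasPerm hπ⟩

theorem rotheBPD_isGood (hπ : IsSplit π k) : (rotheBPD π).IsGood π k := by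
  refine ⟨fun _ _ _ => rfl, fun i j hj => ?_⟩
  simp only [rotheBPD, rotheTile]
  split_ifs with h1 h2 h3 <;> simp
  have := hπ.lt i (π⁻¹ j) (by simpa using h2) (Or.inl (by simpa using hj))
  exact absurd h3 this.not_gt

theorem IsGood.lt_of_blank (hπ : IsSplit π k) (h : D.IsGood π k) {i j : Fin n}
    (hb : D.tile i j = .blank) : (j : ℕ) < k := by
  by_contra hcon
  rw [h.right i j (not_lt.1 hcon), rotheTile] at hb
  split_ifs at hb with h1 h2 h3 h4
  have := hπ.lt (π⁻¹ j) i
    (by simpa using lt_of_le_of_ne (not_lt.1 h2) (Ne.symm h1)) (Or.inr (by simpa using hcon))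
  exact h4 this

end BPD

end PipeDreams

namespace PipeDreams

namespace BPD

variable {n : ℕ} {D D' : BPD n} {π : Equiv.Perm (Fin n)} {k : ℕ}

/-! ### Simple droops -/

/-- `D'` arises from `D` by a simple droop in the square with rows `i`, `i'` and columns
`j`, `j'`. -/
def DroopAt (D D' : BPD n) (i i' j j' : Fin n) : Prop :=
  (i' : ℕ) = i + 1 ∧ (j' : ℕ) = j + 1 ∧
    D.tile i j = .rElbow ∧ D'.tile i j = .blank ∧
    D.tile i' j' = .blank ∧ D'.tile i' j' = .jElbow ∧
    ((D.tile i j' = .horiz ∧ D'.tile i j' = .rElbow) ∨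
      (D.tile i j' = .jElbow ∧ D'.tile i j' = .vert)) ∧
    ((D.tile i' j = .vert ∧ D'.tile i' j = .rElbow) ∨
      (D.tile i' j = .jElbow ∧ D'.tile i' j = .horiz)) ∧
    ∀ a b : Fin n, ¬ ((a = i ∨ a = i') ∧ (b = j ∨ b = j')) → D'.tile a b = D.tile a b

/-- A `2 × 2` square may be filled in any other way which leaves its outer edges as they are. -/
theorem exists_replace (D : BPD n) {i i' j j' : Fin n} (hi : (i' : ℕ) = i + 1)
    (hj : (j' : ℕ) = j + 1) {t₁ t₂ t₃ t₄ : BTile}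
    (h₁ : t₁.north = (D.tile i j).north ∧ t₁.west = (D.tile i j).west)
    (h₂ : t₂.north = (D.tile i j').north ∧ t₂.east = (D.tile i j').east)
    (h₃ : t₃.south = (D.tile i' j).south ∧ t₃.west = (D.tile i' j).west)
    (h₄ : t₄.south = (D.tile i' j').south ∧ t₄.east = (D.tile i' j').east)
    (h₁₂ : t₁.east = t₂.west) (h₃₄ : t₃.east = t₄.west)
    (h₁₃ : t₁.south = t₃.north) (h₂₄ : t₂.south = t₄.north) :
    ∃ D' : BPD n, D'.tile i j = t₁ ∧ D'.tile i j' = t₂ ∧ D'.tile i' j = t₃ ∧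
      D'.tile i' j' = t₄ ∧
      ∀ a b : Fin n, ¬ ((a = i ∨ a = i') ∧ (b = j ∨ b = j')) → D'.tile a b = D.tile a b := by
  have hne : i ≠ i' := fun h => by subst h; omega
  have hne' : j ≠ j' := fun h => by subst h; omega
  let T : Fin n → Fin n → BTile := fun a b =>
    if a = i then (if b = j then t₁ else if b = j' then t₂ else D.tile a b)
    else if a = i' then (if b = j then t₃ else if b = j' then t₄ else D.tile a b)
    else D.tile a b
  refine ⟨⟨T, ?_, ?_, ?_, ?_, ?_, ?_⟩, ?_, ?_, ?_, ?_, ?_⟩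
  · intro a b b' hb
    have := D.fit_horizontal a b b' hb
    have q₁ : b = j ↔ b' = j' := by rw [Fin.ext_iff, Fin.ext_iff]; omega
    have q₂ : b = j' → b' ≠ j := fun e => by subst e; rintro rfl; omega
    have q₃ : b ≠ b' := fun e => by subst e; omega
    simp only [T]
    grind
  · intro a a' b ha
    have := D.fit_vertical a a' b ha
    have q₁ : a = i ↔ a' = i' := by rw [Fin.ext_iff, Fin.ext_iff]; omega
    have q₂ : a = i' → a' ≠ i := fun e => by subst e; rintro rfl; omega
    have q₃ : a ≠ a' := fun e => by subst e; omega
    simp only [T]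
    grind
  · intro a b h
    have := D.border_north a b h
    have q : a ≠ i' := fun e => by subst e; omega
    simp only [T]
    grind
  · intro a b h
    have := D.border_west a b h
    have q : b ≠ j' := fun e => by subst e; omega
    simp only [T]
    grind
  · intro a b h
    have := D.border_south a b h
    have q : a ≠ i := fun e => by subst e; omega
    simp only [T]
    grind
  · intro a b h
    have := D.border_east a b h
    have q : b ≠ j := fun e => by subst e; omega
    simp only [T]
    grind
  · simp [T]
  · simp [T, hne'.symm]
  · simp [T, hne.symm]
  · simp [T, hne.symm, hne'.symm]
  · intro a b h
    simp only [T]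
    grind

/-- In a good bumpless pipe dream, a simple droop is possible in each square of which only the SE
corner is blank: the edges leave no other choice for the other three tiles, because there is no
cross-tile. -/
theorem IsGood.exists_droopAt (hπ : IsSplit π k) (h : D.IsGood π k) {i i' j j' : Fin n}
    (hi : (i' : ℕ) = i + 1) (hj : (j' : ℕ) = j + 1) (h₁ : D.tile i j ≠ .blank)
    (h₂ : D.tile i j' ≠ .blank) (h₃ : D.tile i' j ≠ .blank) (h₄ : D.tile i' j' = .blank) :
    ∃ D', DroopAt D D' i i' j j' := by
  have hk := h.lt_of_blank hπ h₄
  have c₁ := h.left i j (by omega)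
  have f₁ := D.fit_horizontal i j j' hj
  have f₂ := D.fit_horizontal i' j j' hj
  have f₃ := D.fit_vertical i i' j hi
  have f₄ := D.fit_vertical i i' j' hi
  have c₂ := h.left i j' hk
  have c₃ := h.left i' j (by omega)
  obtain ⟨e₁, e₂, e₃⟩ : D.tile i j = .rElbow ∧
      (D.tile i j' = .horiz ∨ D.tile i j' = .jElbow) ∧
      (D.tile i' j = .vert ∨ D.tile i' j = .jElbow) := by
    rw [h₄] at f₂ f₄
    revert f₁ f₂ f₃ f₄ c₁ c₂ c₃ h₁ h₂ h₃
    cases D.tile i j <;> cases D.tile i j' <;> cases D.tile i' j <;>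
      simp [BTile.north, BTile.south, BTile.east, BTile.west]
  obtain ⟨D', d₁, d₂, d₃, d₄, d₅⟩ := D.exists_replace hi hj (t₁ := .blank)
    (t₂ := if D.tile i j' = .horiz then .rElbow else .vert)
    (t₃ := if D.tile i' j = .vert then .rElbow else .horiz) (t₄ := .jElbow)
    (by simp [e₁, BTile.north, BTile.west])
    (by rcases e₂ with e | e <;> simp [e, BTile.north, BTile.east])
    (by rcases e₃ with e | e <;> simp [e, BTile.south, BTile.west])
    (by simp [h₄, BTile.south, BTile.east])
    (by rcases e₂ with e | e <;> simp [e, BTile.west, BTile.east])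
    (by rcases e₃ with e | e <;> simp [e, BTile.east, BTile.west])
    (by rcases e₃ with e | e <;> simp [e, BTile.south, BTile.north])
    (by rcases e₂ with e | e <;> simp [e, BTile.south, BTile.north])
  refine ⟨D', hi, hj, e₁, d₁, h₄, d₄, ?_, ?_, d₅⟩
  · rcases e₂ with e | e <;> simp [e, d₂]
  · rcases e₃ with e | e <;> simp [e, d₃]

theorem IsGood.of_eq_outside (h : D.IsGood π k) {i i' j j' : Fin n} (hj : (j : ℕ) < k)
    (hj' : (j' : ℕ) < k)
    (hin : ∀ a b : Fin n, ((a = i ∨ a = i') ∧ (b = j ∨ b = j')) → D'.tile a b ≠ .cross)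
    (hout : ∀ a b : Fin n, ¬ ((a = i ∨ a = i') ∧ (b = j ∨ b = j')) →
      D'.tile a b = D.tile a b) : D'.IsGood π k := by
  constructor
  · intro a b hb
    rw [hout a b, h.right a b hb]
    rintro ⟨-, rfl | rfl⟩ <;> omega
  · intro a b hb
    by_cases hab : (a = i ∨ a = i') ∧ (b = j ∨ b = j')
    · exact hin a b hab
    · rw [hout a b hab]
      exact h.left a b hb

theorem DroopAt.isGood (hπ : IsSplit π k) (h : D.IsGood π k) {i i' j j' : Fin n}
    (hd : DroopAt D D' i i' j j') : D'.IsGood π k := by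
  obtain ⟨-, hj, -, e₁, h₄, e₄, e₂, e₃, hout⟩ := hd
  have hk := h.lt_of_blank hπ h₄
  refine h.of_eq_outside (by omega) hk ?_ hout
  rintro a b ⟨rfl | rfl, rfl | rfl⟩
  · simp [e₁]
  · rcases e₂ with e | e <;> simp [e.2]
  · rcases e₃ with e | e <;> simp [e.2]
  · simp [e₄]

theorem IsGood.lt_of_jElbow (h : D.IsGood π k) {i j : Fin n}
    (hb : D.tile i j = .jElbow) : (j : ℕ) < k := by
  by_contra hcon
  rw [h.right i j (not_lt.1 hcon), rotheTile] at hb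
  split_ifs at hb

/-- The north-west neighbourhood of a topmost `jElbow`. -/
theorem IsGood.topmost_jElbow (h : D.IsGood π k) {i' j' : Fin n}
    (hJ : D.tile i' j' = .jElbow) (hmin : ∀ a b, D.tile a b = .jElbow → i' ≤ a) :
    ∃ i j : Fin n, (i' : ℕ) = i + 1 ∧ (j' : ℕ) = j + 1 ∧ D.tile i j = .blank ∧
      (D.tile i j' = .rElbow ∨ D.tile i j' = .vert) ∧
      (D.tile i' j = .rElbow ∨ D.tile i' j = .horiz) := by
  have hk := h.lt_of_jElbow hJ
  have hi0 : (i' : ℕ) ≠ 0 := fun e => by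
    have := D.border_north i' j' e
    simp [hJ, BTile.north] at this
  have hj0 : (j' : ℕ) ≠ 0 := fun e => by
    have := D.border_west i' j' e
    simp [hJ, BTile.west] at this
  obtain ⟨i, hi⟩ : ∃ i : Fin n, (i' : ℕ) = i + 1 := ⟨⟨i' - 1, by omega⟩, by simp only; omega⟩
  obtain ⟨j, hj⟩ : ∃ j : Fin n, (j' : ℕ) = j + 1 := ⟨⟨j' - 1, by omega⟩, by simp only; omega⟩
  refine ⟨i, j, hi, hj, ?_⟩
  have f₁ := D.fit_horizontal i j j' hj
  have f₂ := D.fit_horizontal i' j j' hj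
  have f₃ := D.fit_vertical i i' j hi
  have f₄ := D.fit_vertical i i' j' hi
  have c₁ := h.left i j (by omega)
  have c₂ := h.left i j' hk
  have c₃ := h.left i' j (by omega)
  have m₁ : D.tile i j ≠ .jElbow := fun e => by
    have := hmin i j e
    rw [Fin.le_def] at this
    omega
  rw [hJ] at f₂ f₄
  revert f₁ f₂ f₃ f₄ c₁ c₂ c₃ m₁
  cases D.tile i j <;> cases D.tile i j' <;> cases D.tile i' j <;>
    simp [BTile.north, BTile.south, BTile.east, BTile.west]

theorem exists_topmost_jElbow {a b : Fin n} (hab : D.tile a b = .jElbow) :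
    ∃ i' j', D.tile i' j' = .jElbow ∧ ∀ a b, D.tile a b = .jElbow → i' ≤ a := by
  obtain ⟨p, hp, hmin⟩ := Finset.exists_min_image
    (Finset.univ.filter fun p : Fin n × Fin n => D.tile p.1 p.2 = .jElbow) Prod.fst
    ⟨(a, b), by simpa using hab⟩
  exact ⟨p.1, p.2, by simpa using hp, fun a b h => hmin (a, b) (by simpa using h)⟩

/-- A good bumpless pipe dream with a `jElbow` arises by a simple droop: a topmost `jElbow` can be
pulled back. -/
theorem IsGood.exists_droopStep_to (h : D.IsGood π k) {a b : Fin n}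
    (hab : D.tile a b = .jElbow) : ∃ D₀ : BPD n, D₀.IsGood π k ∧ DroopStep D₀ D := by
  obtain ⟨i', j', hJ, hmin⟩ := exists_topmost_jElbow hab
  obtain ⟨i, j, hi, hj, e₁, e₂, e₃⟩ := h.topmost_jElbow hJ hmin
  have hk := h.lt_of_jElbow hJ
  obtain ⟨D', d₁, d₂, d₃, d₄, d₅⟩ := D.exists_replace hi hj (t₁ := .rElbow)
    (t₂ := if D.tile i j' = .rElbow then .horiz else .jElbow)
    (t₃ := if D.tile i' j = .rElbow then .vert else .jElbow) (t₄ := .blank)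
    (by simp [e₁, BTile.north, BTile.west])
    (by rcases e₂ with e | e <;> simp [e, BTile.north, BTile.east])
    (by rcases e₃ with e | e <;> simp [e, BTile.south, BTile.west])
    (by simp [hJ, BTile.south, BTile.east])
    (by rcases e₂ with e | e <;> simp [e, BTile.west, BTile.east])
    (by rcases e₃ with e | e <;> simp [e, BTile.east, BTile.west])
    (by rcases e₃ with e | e <;> simp [e, BTile.south, BTile.north])
    (by rcases e₂ with e | e <;> simp [e, BTile.south, BTile.north])
  refine ⟨D', h.of_eq_outside (by omega) hk ?_ d₅, i, i', j, j', hi, hj, d₁, e₁, d₄, hJ, ?_, ?_,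
    fun a b hab => (d₅ a b hab).symm⟩
  · rintro a b ⟨rfl | rfl, rfl | rfl⟩
    · simp [d₁]
    · rcases e₂ with e | e <;> simp [d₂, e]
    · rcases e₃ with e | e <;> simp [d₃, e]
    · simp [d₄]
  · rcases e₂ with e | e <;> simp [e, d₂]
  · rcases e₃ with e | e <;> simp [e, d₃]

/-- Without `jElbow`s, each pipe goes straight north and then straight east, so that its `rElbow`
is in the row in which it ends. -/
theorem HasPerm.eq_rotheBPD (h : D.HasPerm π) (hJ : ∀ i j, D.tile i j ≠ .jElbow) :
    D = rotheBPD π := by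
  have hJ' : ∀ i j, D.tileAt i j ≠ .jElbow := by
    intro i j
    unfold tileAt
    split_ifs
    · exact hJ _ _
    · simp
  have vlab : ∀ j < n, ∀ i ≤ n, D.vEdge i j = true → D.vLab i j = j := by
    intro j hj i hi
    induction hi using Nat.decreasingInduction with
    | self => exact fun _ => D.vLab_last j
    | of_succ i hi ih' =>
      have h1 := D.hLab_lt (m := j) hi (by omega)
      have := D.local_cases hi hj
      have := hJ' i j
      grind
  have row : ∀ i < n, ∀ j, D.tileAt i j = .rElbow → ∀ m, j + 1 ≤ m → m ≤ n →
      D.hEdge i m = true ∧ D.hLab i m = j := by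
    intro i hi j ht m hm
    induction m, hm using Nat.le_induction with
    | base =>
      intro hj
      have := vlab j hj (i + 1) hi
      have := D.local_cases hi hj
      grind
    | succ m hm ih =>
      intro hmn
      have ih := ih (by omega)
      have := vlab m hmn (i + 1) hi
      have := D.local_cases hi hmn
      have := hJ' i m
      grind
  have row' : ∀ i < n, ∀ m ≤ n, D.hEdge i m = true → ∃ j < m, D.tileAt i j = .rElbow := by
    intro i hi m
    induction m with
    | zero => simp [hEdge_zero]
    | succ m ih =>
      intro hm he
      have ih := ih (by omega)
      have := D.local_cases hi hm
      grind
  have col : ∀ j < n, ∀ i, D.tileAt i j = .rElbow → ∀ m, i + 1 ≤ m → m ≤ n →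
      D.vEdge m j = true := by
    intro j hj i ht m hm
    induction m, hm using Nat.le_induction with
    | base =>
      intro hi
      have := D.local_cases hi hj
      grind
    | succ m hm ih =>
      intro hmn
      have ih := ih (by omega)
      have := D.local_cases hmn hj
      have := hJ' m j
      grind
  have col' : ∀ j < n, ∀ m ≤ n, D.vEdge m j = true → ∃ i < m, D.tileAt i j = .rElbow := by
    intro j hj m
    induction m with
    | zero => simp [vEdge_zero]
    | succ m ih =>
      intro hm he
      have ih := ih (by omega)
      have := D.local_cases hm hj
      grind
  have elbow : ∀ (i : Fin n) (j : ℕ), j < n → D.tileAt i j = .rElbow → (π i : ℕ) = j := by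
    intro i j hj ht
    rw [← (row i i.2 j ht n hj le_rfl).2]
    exact ((hasPerm_iff_reads.1 h i).2 (π i).2).symm
  have elbow' : ∀ i : Fin n, D.tileAt i (π i) = .rElbow := by
    intro i
    obtain ⟨j, hj, ht⟩ := row' i i.2 n le_rfl (D.hEdge_last i.2)
    rwa [elbow i j hj ht]
  refine ext_of_edges (fun i j hi hj => ?_) (fun i j hi hj => ?_)
  · have h1 : (rotheBPD π).hEdge i (j + 1) = decide (π ⟨i, hi⟩ ≤ ⟨j, hj⟩) := by
      rw [← east_eq, ← rotheTile_east]
      simp [tileAt, hi, hj, rotheBPD]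
    rw [h1, Bool.eq_iff_iff, decide_eq_true_iff, Fin.le_def]
    constructor
    · intro he
      obtain ⟨j', hj', ht⟩ := row' i hi (j + 1) hj he
      rw [elbow ⟨i, hi⟩ j' (by omega) ht]
      simp only; omega
    · intro hle
      exact (row i hi _ (elbow' ⟨i, hi⟩) (j + 1) (by simp only at hle; omega) hj).1
  · have h1 : (rotheBPD π).vEdge (i + 1) j = decide (π⁻¹ ⟨j, hj⟩ ≤ ⟨i, hi⟩) := by
      rw [← south_eq, ← rotheTile_south]
      simp [tileAt, hi, hj, rotheBPD]
    rw [h1, Bool.eq_iff_iff, decide_eq_true_iff, Fin.le_def]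
    constructor
    · intro he
      obtain ⟨i', hi', ht⟩ := col' j hj (i + 1) hi he
      have := elbow ⟨i', by omega⟩ j hj ht
      have e : π⁻¹ ⟨j, hj⟩ = ⟨i', by omega⟩ := by
        rw [Equiv.Perm.inv_eq_iff_eq]
        exact Fin.ext this.symm
      rw [e]
      simp only; omega
    · intro hle
      have := elbow' (π⁻¹ ⟨j, hj⟩)
      rw [show π (π⁻¹ ⟨j, hj⟩) = ⟨j, hj⟩ by simp] at this
      exact col j hj _ this (i + 1) (by simp only at hle; omega) hi

theorem IsGood.eq_rotheBPD (hπ : IsSplit π k) (h : D.IsGood π k)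
    (hJ : ∀ i j, D.tile i j ≠ .jElbow) : D = rotheBPD π :=
  (h.hasPerm hπ).eq_rotheBPD hJ

/-- Pulling back topmost `jElbow`s leads to the Rothe bumpless pipe dream; the process ends because
it increases `rank`. -/
theorem IsGood.rotheBPD_le (hπ : IsSplit π k) (h : D.IsGood π k) : rotheBPD π ≤ D := by
  have bound : ∀ D : BPD n, D.rank ≤ ∑ p : Fin n × Fin n, (p.1 : ℕ) := fun D =>
    Finset.sum_le_sum_of_subset (Finset.subset_univ _)
  generalize hm : ∑ p : Fin n × Fin n, (p.1 : ℕ) - D.rank = m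
  induction m using Nat.strong_induction_on generalizing D with
  | _ m ih =>
    by_cases hJ : ∀ i j, D.tile i j ≠ .jElbow
    · rw [h.eq_rotheBPD hπ hJ]
    · push Not at hJ
      obtain ⟨a, b, hab⟩ := hJ
      obtain ⟨D₀, h₀, hd⟩ := h.exists_droopStep_to hab
      have := hd.rank_lt
      have := bound D₀
      exact Relation.ReflTransGen.tail (ih _ (by omega) h₀ rfl) hd

theorem isGood_of_rotheBPD_le (hπ : IsSplit π k) (h : rotheBPD π ≤ D) : D.IsGood π k := by
  induction (show Relation.ReflTransGen DroopStep (rotheBPD π) D from h) with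
  | refl => exact rotheBPD_isGood hπ
  | tail _ hd ih =>
    obtain ⟨i, i', j, j', hd⟩ := hd
    exact DroopAt.isGood hπ (ih ‹_›) hd

end BPD

theorem mem_bpdSet_iff {n k : ℕ} {π : Equiv.Perm (Fin n)} (hπ : IsSplit π k) {D : BPD n} :
    D ∈ bpdSet π ↔ D.IsGood π k :=
  BPD.hasPerm_iff_isGood hπ

theorem mem_droop_iff {n k : ℕ} {π : Equiv.Perm (Fin n)} (hπ : IsSplit π k) {D : BPD n} :
    D ∈ droop π ↔ D.IsGood π k :=
  ⟨BPD.isGood_of_rotheBPD_le hπ, fun h => h.rotheBPD_le hπ⟩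

end PipeDreams

namespace PipeDreams

/-! ### Words of adjacent transpositions -/

/-- `F 0, F 1, …` is a sequence of words with `F 0 = 0 1 2 …`, in which `F (t + 1)` arises from
`F t` by exchanging the entries at the positions `s t` and `s t + 1` if `c t` holds, and is equal to
`F t` otherwise. -/
structure IsSwapSequence (F : ℕ → ℕ → ℕ) (s : ℕ → ℕ) (c : ℕ → Prop) : Prop where
  zero : ∀ p, F 0 p = p
  swap : ∀ t, c t → ∀ p, F (t + 1) p = F t (Equiv.swap (s t) (s t + 1) p)
  stay : ∀ t, ¬ c t → ∀ p, F (t + 1) p = F t p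

theorem swap_succ_lt_swap_succ {s p q : ℕ} (hpq : p < q) (h : ¬ (p = s ∧ q = s + 1)) :
    Equiv.swap s (s + 1) p < Equiv.swap s (s + 1) q := by
  simp only [Equiv.swap_apply_def]
  split_ifs <;> omega

namespace IsSwapSequence

variable {F : ℕ → ℕ → ℕ} {s : ℕ → ℕ} {c : ℕ → Prop}

theorem injective (h : IsSwapSequence F s c) (t : ℕ) : Function.Injective (F t) := by
  induction t with
  | zero => intro p q e; simpa [h.zero] using e
  | succ t ih =>
    intro p q e
    by_cases hc : c t
    · rw [h.swap t hc, h.swap t hc] at e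
      exact (Equiv.swap _ _).injective (ih e)
    · rw [h.stay t hc, h.stay t hc] at e
      exact ih e

/-- Two entries which are in the wrong order have been exchanged before. -/
theorem exists_swap_of_inversion (h : IsSwapSequence F s c) (t : ℕ) {p q : ℕ} (hpq : p < q)
    (hF : F t q < F t p) :
    ∃ t' < t, c t' ∧ s(F t' (s t'), F t' (s t' + 1)) = s(F t p, F t q) := by
  induction t generalizing p q with
  | zero => rw [h.zero, h.zero] at hF; omega
  | succ t ih =>
    by_cases hc : c t
    · by_cases hs : p = s t ∧ q = s t + 1
      · obtain ⟨rfl, rfl⟩ := hs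
        refine ⟨t, t.lt_succ_self, hc, ?_⟩
        rw [h.swap t hc, h.swap t hc, Equiv.swap_apply_left, Equiv.swap_apply_right]
        exact Sym2.eq_swap
      · rw [h.swap t hc, h.swap t hc] at hF ⊢
        obtain ⟨t', ht', hc', e⟩ := ih (swap_succ_lt_swap_succ hpq hs) hF
        exact ⟨t', by omega, hc', e⟩
    · rw [h.stay t hc, h.stay t hc] at hF ⊢
      obtain ⟨t', ht', hc', e⟩ := ih hpq hF
      exact ⟨t', by omega, hc', e⟩

/-- If each exchange creates an inversion, then entries which have been exchanged stay in the wrong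
order. -/
theorem inversion_of_swap (h : IsSwapSequence F s c)
    (hasc : ∀ t, c t → F t (s t) < F t (s t + 1)) {t t' : ℕ} (ht : t' < t) (hc' : c t') {p q : ℕ}
    (hpq : p < q) (e : s(F t' (s t'), F t' (s t' + 1)) = s(F t p, F t q)) : F t q < F t p := by
  induction t generalizing p q with
  | zero => omega
  | succ t ih =>
    by_cases hc : c t
    · rw [h.swap t hc, h.swap t hc] at e ⊢
      by_cases hs : p = s t ∧ q = s t + 1
      · obtain ⟨rfl, rfl⟩ := hs
        rw [Equiv.swap_apply_left, Equiv.swap_apply_right]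
        exact hasc t hc
      · have hlt := swap_succ_lt_swap_succ hpq hs
        rcases Nat.lt_succ_iff_lt_or_eq.1 ht with h1 | rfl
        · exact ih h1 hlt e
        · have hinj := h.injective t'
          rcases Sym2.eq_iff.1 e with ⟨e1, e2⟩ | ⟨e1, e2⟩
          · have e1 := hinj e1
            have e2 := hinj e2
            simp only [Equiv.swap_apply_def] at e1 e2 hlt
            split_ifs at e1 e2 <;> omega
          · have e1 := hinj e1
            have e2 := hinj e2
            omega
    · rw [h.stay t hc, h.stay t hc] at e ⊢
      rcases Nat.lt_succ_iff_lt_or_eq.1 ht with h1 | rfl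
      · exact ih h1 hpq e
      · exact absurd hc' hc

theorem eq_of_le (h : IsSwapSequence F s c) {n : ℕ} (hs : ∀ t, c t → s t + 1 < n) (t : ℕ) {p : ℕ}
    (hp : n ≤ p) : F t p = p := by
  induction t with
  | zero => exact h.zero p
  | succ t ih =>
    by_cases hc : c t
    · have := hs t hc
      rw [h.swap t hc, Equiv.swap_apply_of_ne_of_ne (by omega) (by omega), ih]
    · rw [h.stay t hc, ih]

theorem lt_of_lt (h : IsSwapSequence F s c) {n : ℕ} (hs : ∀ t, c t → s t + 1 < n) (t : ℕ) {p : ℕ}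
    (hp : p < n) : F t p < n := by
  by_contra hcon
  have := h.injective t (h.eq_of_le hs t (not_lt.1 hcon))
  omega

end IsSwapSequence

namespace PD

variable {n : ℕ} (P : PD n)

/-! ### The words of a pipe dream -/

theorem tileAt_coe (i j : Fin n) : P.tileAt i j = P.tile i j := by
  simp [tileAt]

theorem add_lt_of_cross {i j : ℕ} (h : P.tileAt i j = .cross) : i + j + 1 < n := by
  unfold tileAt at h
  split_ifs at h with hij
  by_contra hcon
  rw [P.elbow_below _ _ (by simpa using hcon)] at h
  cases h

theorem lt_and_lt_of_cross {i j : ℕ} (h : P.tileAt i j = .cross) : i < n ∧ j < n := by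
  have := P.add_lt_of_cross h
  omega

theorem vLabel_zero (j : ℕ) : P.vLabel 0 j = j := by rw [vLabel]

theorem vLabel_succ_of_cross {i j : ℕ} (h : P.tileAt i j = .cross) :
    P.vLabel (i + 1) j = P.vLabel i j := by rw [vLabel, if_pos h]

theorem vLabel_succ_of_not_cross {i j : ℕ} (h : P.tileAt i j ≠ .cross) :
    P.vLabel (i + 1) j = P.hLabel i (j + 1) := by rw [vLabel, if_neg h]

theorem hLabel_of_cross {i j : ℕ} (h : P.tileAt i j = .cross) :
    P.hLabel i j = P.hLabel i (j + 1) := by rw [hLabel, dif_pos h]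

theorem hLabel_of_not_cross {i j : ℕ} (h : P.tileAt i j ≠ .cross) :
    P.hLabel i j = P.vLabel i j := by rw [hLabel, dif_neg h]

theorem not_cross_of_le {i j : ℕ} (h : n ≤ i + j + 1) : P.tileAt i j ≠ .cross := fun e => by
  have := P.add_lt_of_cross e
  omega

/-- The labels on the path which runs from the NW corner of the grid along the west border to row
`i`, along the upper edge of this row, in front of column `j` through the row, and along its lower
edge. This is the situation after the tiles of the rows above row `i` and those of row `i` from
column `j` on have been passed. -/
def front (i j p : ℕ) : ℕ :=
  if p < i then P.hLabel p 0
  else if p < i + j then P.vLabel i (p - i)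
  else if p = i + j then P.hLabel i j
  else P.vLabel (i + 1) (p - i - 1)

theorem front_of_cross {i j : ℕ} (h : P.tileAt i j = .cross) (p : ℕ) :
    P.front i j p = P.front i (j + 1) (Equiv.swap (i + j) (i + j + 1) p) := by
  rw [Equiv.swap_apply_def]
  unfold front
  by_cases h1 : p = i + j
  · subst h1
    simp only [P.hLabel_of_cross h, ← add_assoc, if_true, lt_irrefl, if_false]
    rw [if_neg (by omega), if_neg (by omega)]
  · by_cases h2 : p = i + j + 1
    · subst h2
      have e : i + j + 1 - i - 1 = j := by omega
      simp [e, P.vLabel_succ_of_cross h]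
      omega
    · rw [if_neg h1, if_neg h2]
      split_ifs <;> first | rfl | omega

theorem front_of_not_cross {i j : ℕ} (h : P.tileAt i j ≠ .cross) (p : ℕ) :
    P.front i j p = P.front i (j + 1) p := by
  unfold front
  by_cases h1 : p = i + j
  · subst h1
    simp [P.hLabel_of_not_cross h]
  · by_cases h2 : p = i + j + 1
    · subst h2
      have e : i + j + 1 - i - 1 = j := by omega
      simp [e, P.vLabel_succ_of_not_cross h, ← add_assoc]
    · split_ifs <;> first | rfl | omega

theorem vLabel_succ_of_le {i j : ℕ} (hj : n ≤ j) : P.vLabel (i + 1) j = P.vLabel i (j + 1) := by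
  rw [P.vLabel_succ_of_not_cross (P.not_cross_of_le (by omega)),
    P.hLabel_of_not_cross (P.not_cross_of_le (by omega))]

theorem front_zero_last (p : ℕ) : P.front 0 n p = p := by
  unfold front
  split_ifs with h1 h2 h3
  · omega
  · simp [vLabel_zero]
  · rw [P.hLabel_of_not_cross (P.not_cross_of_le (by omega)), vLabel_zero]
    omega
  · rw [P.vLabel_succ_of_le (by omega), vLabel_zero]
    omega

theorem front_succ_last (i p : ℕ) : P.front (i + 1) n p = P.front i 0 p := by
  unfold front
  by_cases h1 : p < i
  · rw [if_pos h1, if_pos (by omega)]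
  by_cases h2 : p = i
  · subst h2; simp
  rw [if_neg (show ¬ p < i + 1 by omega), if_neg h1, if_neg (show ¬ p < i + 0 by omega),
    if_neg (show ¬ p = i + 0 by omega)]
  split_ifs with h3 h4
  · rw [Nat.sub_sub]
  · rw [P.hLabel_of_not_cross (P.not_cross_of_le (by omega))]
    congr 1; omega
  · rw [P.vLabel_succ_of_le (by omega)]
    congr 1; omega

/-- The words of a pipe dream: the tiles are passed row by row from top to bottom, and from right to
left in each row; the tile `(i, j)` acts on the positions `i + j` and `i + j + 1`. -/
theorem isSwapSequence_front (hn : 0 < n) :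
    IsSwapSequence (fun t => P.front (t / n) (n - t % n))
      (fun t => t / n + (n - 1 - t % n))
      (fun t => P.tileAt (t / n) (n - 1 - t % n) = .cross) := by
  have step : ∀ t p, P.front ((t + 1) / n) (n - (t + 1) % n) p =
      P.front (t / n) (n - 1 - t % n) p := by
    intro t p
    have hlt := Nat.mod_lt t hn
    by_cases h : t % n + 1 = n
    · have h1 : (t + 1) % n = 0 := by
        rw [Nat.add_mod, ← Nat.mod_add_mod]
        rcases Nat.lt_or_ge 1 n with h2 | h2
        · rw [Nat.mod_mod, Nat.mod_eq_of_lt h2, h, Nat.mod_self]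
        · obtain rfl : n = 1 := by omega
          simp [Nat.mod_one]
      have h2 : (t + 1) / n = t / n + 1 := by
        rw [Nat.succ_div_of_mod_eq_zero h1]
      rw [h1, h2, Nat.sub_zero, front_succ_last]
      congr 1; omega
    · have h1 : (t + 1) % n = t % n + 1 := by
        rw [Nat.add_mod, Nat.mod_eq_of_lt (a := 1) (by omega), Nat.mod_eq_of_lt (by omega)]
      have h2 : (t + 1) / n = t / n := by
        rw [Nat.succ_div_of_mod_ne_zero (by omega)]
      rw [h1, h2]
      congr 1; omega
  have hsub : ∀ t, n - t % n = n - 1 - t % n + 1 := fun t => by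
    have := Nat.mod_lt t hn
    omega
  refine ⟨fun p => ?_, fun t hc p => ?_, fun t hc p => ?_⟩
  · simp [front_zero_last]
  · rw [step, P.front_of_cross hc, hsub t]
  · rw [step, P.front_of_not_cross hc, hsub t]

/-- The moment at which the tile `(i, j)` is passed. -/
def time (n i j : ℕ) : ℕ := i * n + (n - 1 - j)

theorem time_div {i j : ℕ} (hj : j < n) : time n i j / n = i := by
  rw [time, mul_comm, Nat.mul_add_div (by omega), Nat.div_eq_of_lt (by omega), add_zero]

theorem time_mod {i j : ℕ} (hj : j < n) : time n i j % n = n - 1 - j := by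
  rw [time, mul_comm, Nat.mul_add_mod, Nat.mod_eq_of_lt (by omega)]

theorem front_left {i j : ℕ} : P.front i (j + 1) (i + j) = P.vLabel i j := by
  simp [front]

theorem front_right {i j : ℕ} : P.front i (j + 1) (i + j + 1) = P.hLabel i (j + 1) := by
  simp [front, ← add_assoc]
  omega

theorem vLabel_of_le {i j : ℕ} (h : n ≤ i + j) : P.vLabel i j = i + j := by
  induction i generalizing j with
  | zero => rw [vLabel_zero, zero_add]
  | succ i ih =>
    rw [P.vLabel_succ_of_not_cross (P.not_cross_of_le (by omega)),
      P.hLabel_of_not_cross (P.not_cross_of_le (by omega)), ih (by omega)]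
    omega

/-- Pipes travel towards south and west, so a label is at least the index of its column. -/
theorem le_vLabel_and_le_hLabel (i : ℕ) : (∀ j, j ≤ P.vLabel i j) ∧ ∀ j, j ≤ P.hLabel i j := by
  have hrow : ∀ i, (∀ j, j ≤ P.vLabel i j) → ∀ j, j ≤ P.hLabel i j := by
    intro i hv j
    rcases le_total n j with hj | hj
    · rw [P.hLabel_of_not_cross (P.not_cross_of_le (by omega))]
      exact hv j
    · induction hj using Nat.decreasingInduction with
      | self =>
        rw [P.hLabel_of_not_cross (P.not_cross_of_le (by omega))]
        exact hv n
      | of_succ j hj ih =>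
        by_cases hc : P.tileAt i j = .cross
        · rw [P.hLabel_of_cross hc]; omega
        · rw [P.hLabel_of_not_cross hc]; exact hv j
  induction i with
  | zero =>
    have : ∀ j, j ≤ P.vLabel 0 j := fun j => by rw [vLabel_zero]
    exact ⟨this, hrow 0 this⟩
  | succ i ih =>
    have : ∀ j, j ≤ P.vLabel (i + 1) j := fun j => by
      by_cases hc : P.tileAt i j = .cross
      · rw [P.vLabel_succ_of_cross hc]; exact ih.1 j
      · rw [P.vLabel_succ_of_not_cross hc]
        have := ih.2 (j + 1)
        omega
    exact ⟨this, hrow _ this⟩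

end PD

end PipeDreams

namespace PipeDreams

namespace PD

variable {n : ℕ} {P : PD n} {π : Equiv.Perm (Fin n)} {k : ℕ}

/-! ### The reduced pipe dreams of a permutation -/

theorem front_last (P : PD n) {p : ℕ} (hp : p < n) : P.front (n * n / n) (n - n * n % n) p =
    P.hLabel p 0 := by
  rw [Nat.mul_div_cancel _ (by omega), Nat.mul_mod_left, front, if_pos hp]

theorem swap_lt (P : PD n) (t : ℕ) (h : P.tileAt (t / n) (n - 1 - t % n) = .cross) :
    t / n + (n - 1 - t % n) + 1 < n :=
  P.add_lt_of_cross h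

theorem hLabel_zero_lt (P : PD n) {p : ℕ} (hp : p < n) : P.hLabel p 0 < n := by
  rw [← P.front_last hp]
  exact (P.isSwapSequence_front (by omega)).lt_of_lt P.swap_lt _ hp

theorem eq_of_hLabel_zero_eq (P : PD n) {p q : ℕ} (hp : p < n) (hq : q < n)
    (h : P.hLabel p 0 = P.hLabel q 0) : p = q := by
  rw [← P.front_last hp, ← P.front_last hq] at h
  exact (P.isSwapSequence_front (by omega)).injective _ h

theorem cross_time {i j : Fin n} (h : P.tile i j = .cross) :
    P.tileAt (time n i j / n) (n - 1 - time n i j % n) = .cross := by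
  rw [time_div j.2, time_mod j.2, show n - 1 - (n - 1 - (j : ℕ)) = j by omega, tileAt_coe, h]

theorem front_of_cell (P : PD n) (t : ℕ) (h : P.tileAt (t / n) (n - 1 - t % n) = .cross) :
    P.front (t / n) (n - t % n) (t / n + (n - 1 - t % n)) = P.vLabel (t / n) (n - 1 - t % n) ∧
    P.front (t / n) (n - t % n) (t / n + (n - 1 - t % n) + 1) =
      P.hLabel (t / n) (n - 1 - t % n) := by
  have h1 := P.swap_lt t h
  have h2 := Nat.mod_lt t (Nat.zero_lt_of_lt h1)
  have h3 : n - t % n = n - 1 - t % n + 1 := by omega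
  rw [h3, front_left, front_right, P.hLabel_of_cross h]
  exact ⟨rfl, rfl⟩

theorem front_time {i j : Fin n} (h : P.tile i j = .cross) :
    P.front (time n i j / n) (n - time n i j % n)
      (time n i j / n + (n - 1 - time n i j % n)) = P.vLabel i j ∧
    P.front (time n i j / n) (n - time n i j % n)
      (time n i j / n + (n - 1 - time n i j % n) + 1) = P.hLabel i j := by
  have := P.front_of_cell _ (cross_time h)
  rwa [time_mod j.2, time_div j.2, show n - 1 - (n - 1 - (j : ℕ)) = j by omega] at this ⊢

/-- If at each cross-tile the smaller label comes from the north, then each exchange creates an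
inversion. -/
theorem front_lt_front (h : ∀ i j : Fin n, P.tile i j = .cross → P.vLabel i j < P.hLabel i j)
    (t : ℕ) (hc : P.tileAt (t / n) (n - 1 - t % n) = .cross) :
    P.front (t / n) (n - t % n) (t / n + (n - 1 - t % n)) <
      P.front (t / n) (n - t % n) (t / n + (n - 1 - t % n) + 1) := by
  obtain ⟨l1, l2⟩ := P.front_of_cell t hc
  have hlt := P.lt_and_lt_of_cross hc
  rw [l1, l2]
  exact h ⟨t / n, hlt.1⟩ ⟨n - 1 - t % n, hlt.2⟩ (by rwa [← tileAt_coe])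

/-- A pipe dream is reduced if and only if at each cross-tile the smaller label comes from the
north. -/
theorem isReduced_iff :
    P.IsReduced ↔ ∀ i j : Fin n, P.tile i j = .cross → P.vLabel i j < P.hLabel i j := by
  constructor
  · intro hred i j hij
    have hF := P.isSwapSequence_front j.pos
    obtain ⟨l1, l2⟩ := front_time hij
    by_contra hcon
    have hne : P.vLabel i j ≠ P.hLabel i j := by
      rw [← l1, ← l2]
      exact fun e => absurd (hF.injective _ e) (Nat.lt_succ_self _).ne
    obtain ⟨t, ht, hc, e⟩ := hF.exists_swap_of_inversion (time n i j)
      (p := time n i j / n + (n - 1 - time n i j % n)) (Nat.lt_succ_self _)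
      (by rw [l1, l2]; omega)
    obtain ⟨l1', l2'⟩ := P.front_of_cell t hc
    rw [l1, l2, l1', l2'] at e
    have hlt := P.lt_and_lt_of_cross hc
    have := hred (⟨t / n, hlt.1⟩, ⟨n - 1 - t % n, hlt.2⟩)
      (by simpa [crosses, ← tileAt_coe] using hc) (i, j) (by simpa [crosses] using hij) e
    simp only [Prod.mk.injEq, Fin.ext_iff] at this
    have h1 := Nat.div_add_mod t n
    have h2 := Nat.mod_lt t j.pos
    have h3 : time n i j = t := by
      rw [time, ← this.1, ← this.2, mul_comm]
      omega
    omega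
  · intro hasc
    have key : ∀ p ∈ P.crosses, ∀ q ∈ P.crosses, P.crossingPair p = P.crossingPair q →
        ¬ time n p.1 p.2 < time n q.1 q.2 := by
      intro p hp q hq e hlt
      simp only [crosses, Finset.mem_filter, Finset.mem_univ, true_and] at hp hq
      have := (P.isSwapSequence_front p.1.pos).inversion_of_swap (front_lt_front hasc) hlt
        (cross_time hp) (Nat.lt_succ_self _)
        (by rw [(front_time hp).1, (front_time hp).2, (front_time hq).1, (front_time hq).2]; exact e)
      exact absurd (front_lt_front hasc _ (cross_time hq)) this.not_gt
    intro p hp q hq e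
    have h1 := key p hp q hq e
    have h2 := key q hq p hp e.symm
    have h3 : time n p.1 p.2 = time n q.1 q.2 := by omega
    have h4 := congrArg (· / n) h3
    have h5 := congrArg (· % n) h3
    simp only [time_div (Fin.is_lt _), time_mod (Fin.is_lt _)] at h4 h5
    exact Prod.ext (Fin.ext h4) (Fin.ext (by omega))

theorem vLabel_lt_of_cross {i j : Fin n} (h : P.tile i j = .cross) : P.vLabel i j < n := by
  have hs := P.swap_lt _ (cross_time h)
  rw [← (front_time h).1]
  exact (P.isSwapSequence_front j.pos).lt_of_lt P.swap_lt _ (by omega)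

theorem hLabel_lt_of_cross {i j : Fin n} (h : P.tile i j = .cross) : P.hLabel i j < n := by
  have hs := P.swap_lt _ (cross_time h)
  rw [← (front_time h).2]
  exact (P.isSwapSequence_front j.pos).lt_of_lt P.swap_lt _ hs

/-- Two pipes which leave in the wrong order have crossed. -/
theorem exists_cross_of_row_inversion (P : PD n) {p q : ℕ} (hpq : p < q) (hq : q < n)
    (h : P.hLabel q 0 < P.hLabel p 0) :
    ∃ i j : Fin n, P.tile i j = .cross ∧
      s(P.vLabel i j, P.hLabel i j) = s(P.hLabel p 0, P.hLabel q 0) := by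
  rw [← P.front_last hq, ← P.front_last (hpq.trans hq)] at h ⊢
  obtain ⟨t, -, hc, e⟩ :=
    (P.isSwapSequence_front (show 0 < n by omega)).exists_swap_of_inversion _ hpq h
  obtain ⟨l1, l2⟩ := P.front_of_cell t hc
  have hlt := P.lt_and_lt_of_cross hc
  refine ⟨⟨t / n, hlt.1⟩, ⟨n - 1 - t % n, hlt.2⟩, by rwa [← tileAt_coe], ?_⟩
  rw [← e, l1, l2]

/-- In a reduced pipe dream, two pipes which have crossed leave in the wrong order. -/
theorem IsReduced.row_inversion (hP : P.IsReduced) {i j : Fin n} (hc : P.tile i j = .cross)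
    {p q : ℕ} (hpq : p < q) (hq : q < n)
    (e : s(P.vLabel i j, P.hLabel i j) = s(P.hLabel p 0, P.hLabel q 0)) :
    P.hLabel q 0 < P.hLabel p 0 := by
  have ht : time n i j < n * n := by
    have := j.2
    calc time n i j < i * n + n := by rw [time]; omega
      _ = (i + 1) * n := by ring
      _ ≤ n * n := Nat.mul_le_mul_right n i.2
  rw [← P.front_last hq, ← P.front_last (hpq.trans hq)] at e ⊢
  refine (P.isSwapSequence_front (show 0 < n by omega)).inversion_of_swap
    (front_lt_front (isReduced_iff.1 hP)) ht (cross_time hc) hpq ?_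
  rw [(front_time hc).1, (front_time hc).2]
  exact e

/-- A description of the elements of `PD^red(π)` in terms of only two colours of pipes, the small
ones with a label below `k` and the large ones: only small pipes coming from the north cross large
pipes, and the pipes leave in rows of the right colours. -/
structure IsGood (P : PD n) (π : Equiv.Perm (Fin n)) (k : ℕ) : Prop where
  cross : ∀ i j : Fin n, P.tile i j = .cross → P.vLabel i j < k ∧ k ≤ P.hLabel i j
  row : ∀ i : Fin n, P.hLabel i 0 < k ↔ (π i : ℕ) < k

theorem isGood_of_mem_pdRedSet (hπ : IsSplit π k) (h : P ∈ pdRedSet π) : P.IsGood π k := by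
  obtain ⟨hred, hperm⟩ := h
  refine ⟨fun i j hij => ?_, fun i => by rw [hperm i]⟩
  have hlt := isReduced_iff.1 hred i j hij
  have hv := vLabel_lt_of_cross hij
  have hh := hLabel_lt_of_cross hij
  set a := π⁻¹ ⟨P.vLabel i j, hv⟩ with ha
  set b := π⁻¹ ⟨P.hLabel i j, hh⟩ with hb
  have ea : P.hLabel a 0 = P.vLabel i j := by rw [hperm, ha]; simp
  have eb : P.hLabel b 0 = P.hLabel i j := by rw [hperm, hb]; simp
  have hba : ¬ a < b := by
    intro hab
    have := hred.row_inversion hij hab b.2 (by rw [ea, eb])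
    omega
  by_contra hcon
  refine hba (hπ.lt a b ?_ ?_)
  · rw [Fin.lt_def, ← hperm, ← hperm, ea, eb]
    exact hlt
  · rw [← hperm, ← hperm, ea, eb]
    omega

theorem IsGood.isReduced (h : P.IsGood π k) : P.IsReduced :=
  isReduced_iff.2 fun i j hij => by
    have := h.cross i j hij
    omega

/-- Pipes of the same colour do not cross, so they leave in increasing order. -/
theorem IsGood.hLabel_lt_hLabel (h : P.IsGood π k) {p q : ℕ} (hpq : p < q) (hq : q < n)
    (hc : P.hLabel p 0 < k ↔ P.hLabel q 0 < k) : P.hLabel p 0 < P.hLabel q 0 := by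
  by_contra hcon
  have hne : P.hLabel p 0 ≠ P.hLabel q 0 := fun e =>
    hpq.ne (P.eq_of_hLabel_zero_eq (hpq.trans hq) hq e)
  obtain ⟨i, j, hij, e⟩ := P.exists_cross_of_row_inversion hpq hq (by omega)
  have h1 := h.cross i j hij
  rcases Sym2.eq_iff.1 e with ⟨e1, e2⟩ | ⟨e1, e2⟩ <;> omega

theorem IsGood.hasPerm (hπ : IsSplit π k) (h : P.IsGood π k) : P.HasPerm π := by
  let f : Fin n → Fin n := fun a => ⟨P.hLabel (π⁻¹ a) 0, P.hLabel_zero_lt (π⁻¹ a).2⟩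
  have hf : StrictMono f := by
    intro a b hab
    simp only [f, Fin.lt_def]
    have ra := h.row (π⁻¹ a)
    have rb := h.row (π⁻¹ b)
    simp only [Equiv.Perm.coe_inv, Equiv.apply_symm_apply] at ra rb ⊢
    rw [Fin.lt_def] at hab
    by_cases hs : (b : ℕ) < k ∨ k ≤ (a : ℕ)
    · have := hπ.lt (π⁻¹ a) (π⁻¹ b) (by simpa using hab) (by simpa using hs)
      exact h.hLabel_lt_hLabel this (Fin.is_lt _) (by rw [ra, rb]; omega)
    · omega
  have hid : f = id := by
    refine hf.range_inj strictMono_id |>.1 ?_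
    rw [Set.range_id, (Finite.injective_iff_surjective.1 hf.injective).range_eq]
  intro i
  have := congrArg Fin.val (congrFun hid (π i))
  simpa [f] using this

theorem mem_pdRedSet_iff (hπ : IsSplit π k) : P ∈ pdRedSet π ↔ P.IsGood π k :=
  ⟨isGood_of_mem_pdRedSet hπ, fun h => ⟨h.isReduced, h.hasPerm hπ⟩⟩

end PD

end PipeDreams

namespace PipeDreams

variable {n : ℕ} {π : Equiv.Perm (Fin n)} {k : ℕ}

theorem PTile.eq_of_cross_iff {t t' : PTile} (h : t = .cross ↔ t' = .cross) : t = t' := by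
  cases t <;> cases t' <;> simp_all

theorem PTile.ne_cross_iff {t : PTile} : t ≠ .cross ↔ t = .elbow := by
  cases t <;> simp

theorem PD.ext_of_cross_iff {P P' : PD n}
    (h : ∀ i j, P.tile i j = .cross ↔ P'.tile i j = .cross) : P = P' :=
  PD.ext (funext fun i => funext fun j => PTile.eq_of_cross_iff (h i j))

/-! ### The reflection of the blank tiles -/

namespace BPD

variable {D D' : BPD n}

/-- The pipe dream whose cross-tiles are the reflections of the blank tiles in the columns before
`k`. (The condition `i + c + 1 < n` is automatic in the cases of interest, see
`IsGood.add_lt_of_blank`.) -/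
def reflect (k : ℕ) (D : BPD n) : PD n where
  tile i c := if (i : ℕ) + c + 1 < n ∧ ∃ j : Fin n, (c : ℕ) + j + 1 = k ∧ D.tile i j = .blank
    then .cross else .elbow
  elbow_below i c h := if_neg (by omega)

/-- The reflection of a blank tile is above the main antidiagonal. Indeed, in the columns before `k`,
the tiles `(i, j)` with `j + n < k + i` form a triangle in the SW corner, and they are all vertical:
a pipe which turned to the east there would have to cross its right neighbour. Hence the tiles with
`j + n = k + i` are met by a pipe from the south and are not blank, either. -/
theorem IsGood.add_lt_of_blank (hπ : IsSplit π k) (h : D.IsGood π k) {i j : Fin n}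
    (hb : D.tile i j = .blank) : (i : ℕ) + k < n + j := by
  have hcross : ∀ i < n, ∀ j < k, D.tileAt i j ≠ .cross := fun i hi j hj => by
    have hjn : j < n := hj.trans_le hπ.le
    simpa [tileAt, hi, hjn] using h.left ⟨i, hi⟩ ⟨j, hjn⟩ hj
  have hk := hπ.le
  have row : ∀ i < n, (∀ j, j + n < k + (i + 1) → D.vEdge (i + 1) j = true) →
      ∀ j, j + n ≤ k + i → D.hEdge i j = false := by
    intro i hi hv j
    induction j with
    | zero => exact fun _ => D.hEdge_zero i
    | succ j ih =>
      intro hj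
      have h1 := ih (by omega)
      have h2 := hv (j + 1) (by omega)
      have h3 := D.local_cases (j := j + 1) hi (by omega)
      have h4 := hcross i hi (j + 1) (by omega)
      grind
  have col : ∀ m ≤ n, ∀ j, j + n < k + m → D.vEdge m j = true := by
    intro m hm
    induction hm using Nat.decreasingInduction with
    | self => exact fun j hj => D.vEdge_last (by omega)
    | of_succ i hi ih =>
      intro j hj
      have h1 := row i hi ih j (by omega)
      have h2 := row i hi ih (j + 1) (by omega)
      have h3 := ih j (by omega)
      have := D.local_cases (j := j) hi (by omega)
      grind
  by_contra hcon
  have h1 := col (i + 1) i.2 j (by omega)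
  rw [← south_eq, tileAt_coe, hb] at h1
  simp [BTile.south] at h1

theorem IsGood.reflect_tile_iff (hπ : IsSplit π k) (h : D.IsGood π k) (i c : Fin n) :
    (D.reflect k).tile i c = .cross ↔ ∃ j : Fin n, (c : ℕ) + j + 1 = k ∧ D.tile i j = .blank := by
  have : (D.reflect k).tile i c = .cross ↔
      (i : ℕ) + c + 1 < n ∧ ∃ j : Fin n, (c : ℕ) + j + 1 = k ∧ D.tile i j = .blank := by
    simp only [reflect]
    split_ifs with h' <;> simp [h']
  rw [this, and_iff_right_iff_imp]
  rintro ⟨j, hj, hb⟩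
  have := h.add_lt_of_blank hπ hb
  omega

theorem IsGood.reflect_tile_eq_cross (hπ : IsSplit π k) (h : D.IsGood π k) {i c j : Fin n}
    (hcj : (c : ℕ) + j + 1 = k) :
    (D.reflect k).tile i c = .cross ↔ D.tile i j = .blank := by
  rw [h.reflect_tile_iff hπ]
  constructor
  · rintro ⟨j', hj', hb⟩
    rwa [show j = j' from Fin.ext (by omega)]
  · exact fun hb => ⟨j, hcj, hb⟩

theorem IsGood.reflect_tile_eq_elbow (hπ : IsSplit π k) (h : D.IsGood π k) {i c j : Fin n}
    (hcj : (c : ℕ) + j + 1 = k) :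
    (D.reflect k).tile i c = .elbow ↔ D.tile i j ≠ .blank := by
  rw [← PTile.ne_cross_iff, Ne, h.reflect_tile_eq_cross hπ hcj]

/-- Under the reflection, the edges of a good bumpless pipe dream `D` record the colours of the
pipes of its image: a vertical segment is met by a pipe of `D` if and only if the pipe of the image
is small there, and a horizontal segment if and only if it is large. -/
theorem IsGood.colours (hπ : IsSplit π k) (h : D.IsGood π k) (i : ℕ) :
    (i ≤ n → ∀ c j, c + j + 1 = k →
      ((D.reflect k).vLabel i c < k ↔ D.vEdge i j = false)) ∧
    (i < n → ∀ c j, c + j = k → ((D.reflect k).hLabel i c < k ↔ D.hEdge i j = true)) := by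
  set P := D.reflect k
  have hk := hπ.le
  have hcross : ∀ i < n, ∀ j < k, D.tileAt i j ≠ .cross := fun i hi j hj => by
    have hjn : j < n := hj.trans_le hπ.le
    simpa [tileAt, hi, hjn] using h.left ⟨i, hi⟩ ⟨j, hjn⟩ hj
  have htile : ∀ i < n, ∀ c j, c + j + 1 = k →
      (P.tileAt i c = .cross ↔ D.tileAt i j = .blank) := fun i hi c j hcj => by
    have hc : c < n := by omega
    have hj : j < n := by omega
    simpa [PD.tileAt, tileAt, hi, hc, hj] using
      h.reflect_tile_eq_cross hπ (i := ⟨i, hi⟩) (c := ⟨c, hc⟩) (j := ⟨j, hj⟩) hcj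
  have row : ∀ i < n, (∀ c j, c + j + 1 = k → (P.vLabel i c < k ↔ D.vEdge i j = false)) →
      ∀ j c, c + j = k → (P.hLabel i c < k ↔ D.hEdge i j = true) := by
    intro i hi hv j
    induction j with
    | zero =>
      intro c hc
      have := (P.le_vLabel_and_le_hLabel i).2 c
      simp only [hEdge_zero, Bool.false_eq_true, iff_false, not_lt]
      omega
    | succ j ih =>
      intro c hc
      have h1 := ih (c + 1) (by omega)
      have h2 := hv c j (by omega)
      have h3 := hcross i hi j (by omega)
      have h4 := htile i hi c j (by omega)
      have h5 := D.local_cases (j := j) hi (by omega)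
      by_cases hx : P.tileAt i c = .cross
      · rw [P.hLabel_of_cross hx]; grind
      · rw [P.hLabel_of_not_cross hx]; grind
  induction i with
  | zero =>
    have h0 : ∀ c j, c + j + 1 = k → (P.vLabel 0 c < k ↔ D.vEdge 0 j = false) := by
      intro c j hcj
      simp only [vEdge_zero, P.vLabel_zero, iff_true]
      omega
    exact ⟨fun _ => h0, fun hi c j => row 0 hi h0 j c⟩
  | succ i ih =>
    have hv : i + 1 ≤ n → ∀ c j, c + j + 1 = k →
        (P.vLabel (i + 1) c < k ↔ D.vEdge (i + 1) j = false) := by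
      intro hi c j hcj
      have h1 := ih.1 (by omega) c j hcj
      have h2 := ih.2 hi (c + 1) j (by omega)
      have h3 := hcross i hi j (by omega)
      have h4 := htile i hi c j (by omega)
      have h5 := D.local_cases (j := j) hi (by omega)
      by_cases hx : P.tileAt i c = .cross
      · rw [P.vLabel_succ_of_cross hx]; grind
      · rw [P.vLabel_succ_of_not_cross hx]; grind
    exact ⟨hv, fun hi c j => row (i + 1) hi (hv hi.le) j c⟩

theorem IsGood.isGood_reflect (hπ : IsSplit π k) (h : D.IsGood π k) :
    (D.reflect k).IsGood π k := by
  constructor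
  · intro i c hic
    obtain ⟨j, hcj, hb⟩ := (h.reflect_tile_iff hπ i c).1 hic
    have hv := (h.colours hπ i).1 i.2.le c j hcj
    have hh := (h.colours hπ i).2 i.2 c (j + 1) (by omega)
    rw [← D.north_eq i.2 j.2, tileAt_coe, hb] at hv
    rw [← east_eq, tileAt_coe, hb] at hh
    simpa [BTile.north, BTile.east, hv] using hh
  · intro i
    rw [(h.colours hπ i).2 i.2 0 k (zero_add k), h.hEdge_iff hπ]

theorem IsGood.eq_of_reflect_eq (hπ : IsSplit π k) (h : D.IsGood π k) (h' : D'.IsGood π k)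
    (e : D.reflect k = D'.reflect k) : D = D' := by
  have right : ∀ i j, i < n → j < n → k ≤ j → D.tileAt i j = D'.tileAt i j := by
    intro i j hi hj hkj
    simpa [tileAt, hi, hj] using (h.right ⟨i, hi⟩ ⟨j, hj⟩ hkj).trans
      (h'.right ⟨i, hi⟩ ⟨j, hj⟩ hkj).symm
  refine ext_of_edges (fun i j hi hj => ?_) (fun i j hi hj => ?_)
  · rcases Nat.lt_or_ge j k with hjk | hjk
    · have h1 := (h.colours hπ i).2 hi (k - 1 - j) (j + 1) (by omega)
      have h2 := (h'.colours hπ i).2 hi (k - 1 - j) (j + 1) (by omega)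
      rw [← e] at h2
      rw [Bool.eq_iff_iff, ← h1, ← h2]
    · rw [← east_eq, ← east_eq, right i j hi hj hjk]
  · rcases Nat.lt_or_ge j k with hjk | hjk
    · have h1 := (h.colours hπ (i + 1)).1 hi (k - 1 - j) j (by omega)
      have h2 := (h'.colours hπ (i + 1)).1 hi (k - 1 - j) j (by omega)
      rw [← e] at h2
      have := h1.symm.trans h2
      revert this
      cases D.vEdge (i + 1) j <;> cases D'.vEdge (i + 1) j <;> simp
    · rw [← south_eq, ← south_eq, right i j hi hj hjk]

end BPD

namespace PD

variable {P P' : PD n}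

/-- The tile of a bumpless pipe dream which is the reflection of the tile `(i, c)` of `P`: it is met
by a pipe at those vertical edges where the pipe of `P` is small, and at those horizontal edges
where it is large. -/
def reflectTile (P : PD n) (k i c : ℕ) : BTile :=
  if P.tileAt i c = .cross then .blank
  else if P.vLabel i c < k then (if P.hLabel i (c + 1) < k then .horiz else .rElbow)
  else (if P.hLabel i (c + 1) < k then .jElbow else .vert)

/-- The edges of a reflected tile, and when it is blank. -/
theorem IsGood.reflectTile_edges (h : P.IsGood π k) (i c : ℕ) :
    (P.reflectTile k i c).north = decide (k ≤ P.vLabel i c) ∧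
    (P.reflectTile k i c).south = decide (k ≤ P.vLabel (i + 1) c) ∧
    (P.reflectTile k i c).east = decide (P.hLabel i c < k) ∧
    (P.reflectTile k i c).west = decide (P.hLabel i (c + 1) < k) ∧
    (P.reflectTile k i c = .blank ↔ P.tileAt i c = .cross) ∧
    P.reflectTile k i c ≠ .cross := by
  unfold reflectTile
  by_cases hx : P.tileAt i c = .cross
  · have hlt := P.add_lt_of_cross hx
    have h1 := h.cross ⟨i, by omega⟩ ⟨c, by omega⟩ (by rwa [← tileAt_coe])
    simp only at h1
    have h2 := P.hLabel_of_cross hx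
    rw [if_pos hx, P.vLabel_succ_of_cross hx, ← h2]
    simp [BTile.north, BTile.south, BTile.east, BTile.west, hx, h1]
  · rw [if_neg hx, P.vLabel_succ_of_not_cross hx, P.hLabel_of_not_cross hx]
    split_ifs with h1 h2 h2 <;>
      simp [BTile.north, BTile.south, BTile.east, BTile.west, hx, h1, h2] <;> omega

/-- Each good pipe dream is the reflection of a good bumpless pipe dream. -/
theorem IsGood.exists_reflect_eq (hπ : IsSplit π k) (h : P.IsGood π k) :
    ∃ D : BPD n, D.IsGood π k ∧ D.reflect k = P := by
  have hk := hπ.le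
  have hT := h.reflectTile_edges
  let T : Fin n → Fin n → BTile := fun i j =>
    if (j : ℕ) < k then P.reflectTile k i (k - 1 - j) else rotheTile π i j
  have hl : ∀ i j : Fin n, (j : ℕ) < k → T i j = P.reflectTile k i (k - 1 - j) :=
    fun i j hj => if_pos hj
  have hr : ∀ i j : Fin n, ¬ (j : ℕ) < k → T i j = rotheTile π i j := fun i j hj => if_neg hj
  let D : BPD n :=
    { tile := T
      fit_horizontal := by
        intro i j j' hj
        by_cases h1 : (j' : ℕ) < k
        · rw [hl i j (by omega), hl i j' h1, (hT _ _).2.2.1, (hT _ _).2.2.2.1,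
            show k - 1 - (j' : ℕ) + 1 = k - 1 - j by omega]
        · by_cases h2 : (j : ℕ) < k
          · rw [hl i j h2, hr i j' h1, (hT _ _).2.2.1, rotheTile_west, decide_eq_decide,
              show k - 1 - (j : ℕ) = 0 by omega, h.row, Fin.lt_def]
            omega
          · rw [hr i j h2, hr i j' h1]
            exact (rotheBPD π).fit_horizontal i j j' hj
      fit_vertical := by
        intro i i' j hi
        by_cases h2 : (j : ℕ) < k
        · rw [hl i j h2, hl i' j h2, (hT _ _).2.1, (hT _ _).1, hi]
        · rw [hr i j h2, hr i' j h2]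
          exact (rotheBPD π).fit_vertical i i' j hi
      border_north := by
        intro i j hi
        by_cases h2 : (j : ℕ) < k
        · rw [hl i j h2, (hT _ _).1, hi, vLabel_zero, decide_eq_false_iff_not]
          omega
        · rw [hr i j h2]
          exact (rotheBPD π).border_north i j hi
      border_west := by
        intro i j hj
        by_cases h2 : (j : ℕ) < k
        · have := (P.le_vLabel_and_le_hLabel i).2 k
          rw [hl i j h2, (hT _ _).2.2.2.1, show k - 1 - (j : ℕ) + 1 = k by omega,
            decide_eq_false_iff_not]
          omega
        · rw [hr i j h2]
          exact (rotheBPD π).border_west i j hj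
      border_south := by
        intro i j hi
        by_cases h2 : (j : ℕ) < k
        · rw [hl i j h2, (hT _ _).2.1, decide_eq_true_iff, P.vLabel_of_le (by omega)]
          omega
        · rw [hr i j h2]
          exact (rotheBPD π).border_south i j hi
      border_east := by
        intro i j hj
        by_cases h2 : (j : ℕ) < k
        · rw [hl i j h2, (hT _ _).2.2.1, decide_eq_true_iff, show k - 1 - (j : ℕ) = 0 by omega,
            h.row]
          omega
        · rw [hr i j h2]
          exact (rotheBPD π).border_east i j hj }
  have hD : D.IsGood π k := by
    refine ⟨fun i j hj => hr i j (by omega), fun i j hj => ?_⟩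
    change T i j ≠ _
    rw [hl i j hj]
    exact (hT _ _).2.2.2.2.2
  refine ⟨D, hD, ext_of_cross_iff fun i c => ?_⟩
  rw [hD.reflect_tile_iff hπ, ← tileAt_coe]
  constructor
  · rintro ⟨j, hcj, hb⟩
    change T i j = _ at hb
    rw [hl i j (by omega), (hT _ _).2.2.2.2.1] at hb
    rwa [show k - 1 - (j : ℕ) = c by omega] at hb
  · intro hc
    have h1 := (h.cross i c (by rwa [← tileAt_coe])).1
    have h2 := (P.le_vLabel_and_le_hLabel i).1 c
    refine ⟨⟨k - 1 - c, by omega⟩, by simp only; omega, ?_⟩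
    change T i _ = _
    rw [hl _ _ (by simp only; omega), (hT _ _).2.2.2.2.1]
    simp only
    rwa [show k - 1 - (k - 1 - (c : ℕ)) = c by omega]

/-! ### Simple droops and simple slides -/

/-- `P'` arises from `P` by a simple slide in the square with rows `i`, `i'` and columns
`j`, `j'`. -/
def SlideAt (P P' : PD n) (i i' j j' : Fin n) : Prop :=
  (i' : ℕ) = i + 1 ∧ (j' : ℕ) = j + 1 ∧
    P.tile i j = .elbow ∧ P.tile i j' = .elbow ∧
    P.tile i' j = .cross ∧ P.tile i' j' = .elbow ∧
    P'.tile i j = .elbow ∧ P'.tile i j' = .cross ∧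
    P'.tile i' j = .elbow ∧ P'.tile i' j' = .elbow ∧
    ∀ a b : Fin n, ¬ ((a = i ∨ a = i') ∧ (b = j ∨ b = j')) → P'.tile a b = P.tile a b

theorem SlideAt.unique {P'' : PD n} {i i' j j' : Fin n} (h : SlideAt P P' i i' j j')
    (h' : SlideAt P P'' i i' j j') : P' = P'' := by
  obtain ⟨-, -, -, -, -, -, e₁, e₂, e₃, e₄, e₅⟩ := h
  obtain ⟨-, -, -, -, -, -, f₁, f₂, f₃, f₄, f₅⟩ := h'
  ext a b : 3
  by_cases hab : (a = i ∨ a = i') ∧ (b = j ∨ b = j')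
  · obtain ⟨rfl | rfl, rfl | rfl⟩ := hab
    · rw [e₁, f₁]
    · rw [e₂, f₂]
    · rw [e₃, f₃]
    · rw [e₄, f₄]
  · rw [e₅ a b hab, f₅ a b hab]

end PD

namespace BPD

variable {D D' : BPD n}

theorem DroopAt.slideAt (hπ : IsSplit π k) (h : D.IsGood π k) {i i' j j' c c' : Fin n}
    (hd : DroopAt D D' i i' j j') (hc : (c : ℕ) + j' + 1 = k) (hc' : (c' : ℕ) + j + 1 = k) :
    PD.SlideAt (D.reflect k) (D'.reflect k) i i' c c' := by
  have h' := hd.isGood hπ h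
  obtain ⟨hi, hj, d₁, e₁, d₄, e₄, e₂, e₃, hout⟩ := hd
  refine ⟨hi, by omega, ?_, ?_, ?_, ?_, ?_, ?_, ?_, ?_, ?_⟩
  · rw [h.reflect_tile_eq_elbow hπ hc]
    rcases e₂ with e | e <;> simp [e.1]
  · rw [h.reflect_tile_eq_elbow hπ hc', d₁]; simp
  · rw [h.reflect_tile_eq_cross hπ hc, d₄]
  · rw [h.reflect_tile_eq_elbow hπ hc']
    rcases e₃ with e | e <;> simp [e.1]
  · rw [h'.reflect_tile_eq_elbow hπ hc]
    rcases e₂ with e | e <;> simp [e.2]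
  · rw [h'.reflect_tile_eq_cross hπ hc', e₁]
  · rw [h'.reflect_tile_eq_elbow hπ hc, e₄]; simp
  · rw [h'.reflect_tile_eq_elbow hπ hc']
    rcases e₃ with e | e <;> simp [e.2]
  · intro a b hab
    refine PTile.eq_of_cross_iff ?_
    rw [h.reflect_tile_iff hπ, h'.reflect_tile_iff hπ]
    refine exists_congr fun m => and_congr_right fun hm => ?_
    rw [hout a m]
    rintro ⟨ha, hb⟩
    refine hab ⟨ha, ?_⟩
    rw [Fin.ext_iff, Fin.ext_iff] at hb ⊢
    omega

theorem IsGood.slideStep_of_droopStep (hπ : IsSplit π k) (h : D.IsGood π k)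
    (hd : DroopStep D D') : D'.IsGood π k ∧ PD.SlideStep (D.reflect k) (D'.reflect k) := by
  obtain ⟨i, i', j, j', hd⟩ := hd
  have hd : DroopAt D D' i i' j j' := hd
  have hk := hπ.le
  have hj := hd.2.1
  have hlt := h.lt_of_blank hπ hd.2.2.2.2.1
  exact ⟨hd.isGood hπ h, i, i', ⟨k - 1 - j', by omega⟩, ⟨k - 1 - j, by omega⟩,
    hd.slideAt hπ h (by simp only; omega) (by simp only; omega)⟩

/-- Each simple slide of the reflection comes from a simple droop. -/
theorem IsGood.exists_droopStep_of_slideStep (hπ : IsSplit π k) (h : D.IsGood π k) {P : PD n}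
    (hs : PD.SlideStep (D.reflect k) P) : ∃ D', DroopStep D D' ∧ D'.reflect k = P := by
  obtain ⟨i, i', c, c', hs⟩ := hs
  have hs : PD.SlideAt (D.reflect k) P i i' c c' := hs
  obtain ⟨hi, hc, s₁, s₂, s₃, s₄, -⟩ := id hs
  obtain ⟨j', hj', hb⟩ := (h.reflect_tile_iff hπ i' c).1 s₃
  rw [h.reflect_tile_eq_elbow hπ hj'] at s₁
  -- In column `0`, the blank tiles form an initial segment, so `j'` is not the first column.
  have hj0 : (j' : ℕ) ≠ 0 := by
    intro e
    have f₁ := D.border_west i j' e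
    have f₂ := D.fit_vertical i i' j' hi
    rw [hb] at f₂
    revert f₁ f₂ s₁
    cases D.tile i j' <;> simp [BTile.west, BTile.south, BTile.north]
  obtain ⟨j, hj⟩ : ∃ j : Fin n, (j' : ℕ) = j + 1 := ⟨⟨j' - 1, by omega⟩, by simp only; omega⟩
  have hcj : (c' : ℕ) + j + 1 = k := by omega
  rw [h.reflect_tile_eq_elbow hπ hcj] at s₂ s₄
  obtain ⟨D', hd⟩ := h.exists_droopAt hπ hi hj s₂ s₁ s₄ hb
  exact ⟨D', ⟨i, i', j, j', hd⟩, (hd.slideAt hπ h hj' hcj).unique hs⟩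

theorem IsGood.droopStep_iff (hπ : IsSplit π k) (h : D.IsGood π k) (h' : D'.IsGood π k) :
    DroopStep D D' ↔ PD.SlideStep (D.reflect k) (D'.reflect k) := by
  refine ⟨fun hd => (h.slideStep_of_droopStep hπ hd).2, fun hs => ?_⟩
  obtain ⟨D'', hd, e⟩ := h.exists_droopStep_of_slideStep hπ hs
  rwa [← (h.slideStep_of_droopStep hπ hd).1.eq_of_reflect_eq hπ h' e]

theorem IsGood.reflect_le_iff (hπ : IsSplit π k) (h : D.IsGood π k) {P : PD n} :
    D.reflect k ≤ P ↔ ∃ D', D'.IsGood π k ∧ D ≤ D' ∧ D'.reflect k = P := by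
  constructor
  · intro hle
    induction (show Relation.ReflTransGen PD.SlideStep (D.reflect k) P from hle) with
    | refl => exact ⟨D, h, le_rfl, rfl⟩
    | tail hle' hs ih =>
      obtain ⟨D₁, h₁, hD₁, rfl⟩ := ih hle'
      obtain ⟨D₂, hd, e⟩ := h₁.exists_droopStep_of_slideStep hπ hs
      exact ⟨D₂, (h₁.slideStep_of_droopStep hπ hd).1, Relation.ReflTransGen.tail hD₁ hd, e⟩
  · rintro ⟨D', -, hle, rfl⟩
    have : D'.IsGood π k ∧ D.reflect k ≤ D'.reflect k := by
      induction (show Relation.ReflTransGen DroopStep D D' from hle) with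
      | refl => exact ⟨h, le_rfl⟩
      | tail hle' hd ih =>
        obtain ⟨h₁, hle₁⟩ := ih hle'
        obtain ⟨h₂, hs⟩ := h₁.slideStep_of_droopStep hπ hd
        exact ⟨h₂, Relation.ReflTransGen.tail hle₁ hs⟩
    exact this.2

theorem IsGood.reflect_le_reflect_iff (hπ : IsSplit π k) (h : D.IsGood π k)
    (h' : D'.IsGood π k) : D.reflect k ≤ D'.reflect k ↔ D ≤ D' := by
  rw [h.reflect_le_iff hπ]
  constructor
  · rintro ⟨D'', h'', hle, e⟩
    rwa [← h''.eq_of_reflect_eq hπ h' e]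
  · exact fun hle => ⟨D', h', hle, rfl⟩

/-! ### Weights, and the bottom pipe dream -/

theorem IsGood.weight_reflect (hπ : IsSplit π k) (h : D.IsGood π k) :
    (D.reflect k).weight = D.weight := by
  have hk := hπ.le
  symm
  unfold weight PD.weight
  refine Finset.prod_bij (fun p hp => (p.1, ⟨k - 1 - p.2, by have := p.1.2; omega⟩)) ?_ ?_ ?_ ?_
  · rintro ⟨i, j⟩ hp
    simp only [blanks, Finset.mem_filter, Finset.mem_univ, true_and] at hp
    have hj := h.lt_of_blank hπ hp
    simp only [PD.crosses, Finset.mem_filter, Finset.mem_univ, true_and]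
    exact (h.reflect_tile_eq_cross hπ (by simp only; omega)).2 hp
  · rintro ⟨i, j⟩ hp ⟨i', j'⟩ hp' e
    simp only [blanks, Finset.mem_filter, Finset.mem_univ, true_and] at hp hp'
    have hj := h.lt_of_blank hπ hp
    have hj' := h.lt_of_blank hπ hp'
    simp only [Prod.mk.injEq, Fin.mk.injEq] at e
    exact Prod.ext e.1 (Fin.ext (by simp only; omega))
  · rintro ⟨i, c⟩ hp
    simp only [PD.crosses, Finset.mem_filter, Finset.mem_univ, true_and] at hp
    obtain ⟨j, hcj, hb⟩ := (h.reflect_tile_iff hπ i c).1 hp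
    refine ⟨(i, j), by simpa [blanks] using hb, Prod.ext rfl (Fin.ext ?_)⟩
    simp only; omega
  · intro p _
    rfl

end BPD

theorem rotheTile_eq_blank_iff (i j : Fin n) :
    rotheTile π i j = .blank ↔ j < π i ∧ i < π⁻¹ j := by
  unfold rotheTile
  have key : π i ≠ j → i ≠ π⁻¹ j := fun h e => h (by rw [e]; simp)
  split_ifs with h1 h2 h3 h4
  · simp [h1]
  · simp [h2.le]
  · simp [h2.le]
  · exact iff_of_false (by simp) fun h => h.2.not_gt h4
  · simp only [true_iff]
    exact ⟨lt_of_le_of_ne (not_lt.1 h2) (Ne.symm h1), lt_of_le_of_ne (not_lt.1 h4) (key h1)⟩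

/-- The Lehmer code counts the blank tiles in the rows of the Rothe bumpless pipe dream. -/
theorem card_blank_rotheTile (i : Fin n) :
    (Finset.univ.filter fun j : Fin n => rotheTile π i j = .blank).card = lehmer π i := by
  symm
  refine Finset.card_bij (fun l _ => π l) ?_ (fun _ _ _ _ e => π.injective e) ?_
  · intro l hl
    simp only [Finset.mem_filter, Finset.mem_univ, true_and, rotheTile_eq_blank_iff] at hl ⊢
    simpa using hl.symm
  · intro j hj
    simp only [Finset.mem_filter, Finset.mem_univ, true_and, rotheTile_eq_blank_iff] at hj
    refine ⟨π⁻¹ j, ?_, by simp⟩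
    simpa using hj.symm

/-- A set of numbers below `k` that is closed upwards has more than `c` elements if and only if it
contains `k - 1 - c`. -/
theorem lt_card_iff_of_upperClosed {S : Finset (Fin n)} (hS : ∀ j ∈ S, (j : ℕ) < k)
    (hup : ∀ j ∈ S, ∀ j' : Fin n, j ≤ j' → (j' : ℕ) < k → j' ∈ S) (hk : k ≤ n) (c : ℕ) :
    c < S.card ↔ ∃ j ∈ S, c + (j : ℕ) + 1 = k := by
  constructor
  · intro hc
    by_contra hcon
    push Not at hcon
    have hsub : S.map Fin.valEmbedding ⊆ Finset.Ico (k - c) k := by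
      intro x hx
      obtain ⟨j, hj, rfl⟩ := Finset.mem_map.1 hx
      have hjk := hS j hj
      simp only [Fin.valEmbedding_apply, Finset.mem_Ico]
      refine ⟨?_, hjk⟩
      by_contra hlt
      exact hcon ⟨k - 1 - c, by omega⟩ (hup j hj _ (by rw [Fin.le_def]; simp only; omega)
        (by simp only; omega)) (by simp only; omega)
    have := Finset.card_le_card hsub
    rw [Finset.card_map, Nat.card_Ico] at this
    omega
  · rintro ⟨j, hj, hc⟩
    have hsub : Finset.Ico (j : ℕ) k ⊆ S.map Fin.valEmbedding := by
      intro x hx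
      rw [Finset.mem_Ico] at hx
      refine Finset.mem_map.2 ⟨⟨x, by omega⟩, hup j hj _ ?_ hx.2, rfl⟩
      rw [Fin.le_def]; exact hx.1
    have := Finset.card_le_card hsub
    rw [Finset.card_map, Nat.card_Ico] at this
    omega

/-- The blank tiles in a row of the Rothe bumpless pipe dream are consecutive and end in column
`k - 1`, so that their reflections are left-justified. -/
theorem reflect_rotheBPD (hπ : IsSplit π k) : (rotheBPD π).reflect k = bottomPD π := by
  have hR := BPD.rotheBPD_isGood hπ
  refine PD.ext_of_cross_iff fun i c => ?_
  have hb : (bottomPD π).tile i c = .cross ↔ (c : ℕ) < lehmer π i := by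
    simp [bottomPD]
  rw [hR.reflect_tile_iff hπ, hb, ← card_blank_rotheTile,
    lt_card_iff_of_upperClosed (k := k) _ _ hπ.le]
  · simp only [Finset.mem_filter, Finset.mem_univ, true_and]
    exact exists_congr fun j => and_comm
  · intro j hj
    exact hR.lt_of_blank hπ (i := i) (by simpa [rotheBPD] using hj)
  · intro j hj j' hjj' hj'
    simp only [Finset.mem_filter, Finset.mem_univ, true_and, rotheTile_eq_blank_iff] at hj ⊢
    -- The values `j ≤ j'` below `k` occur in this order; both occur after row `i`.
    have hle : π⁻¹ j ≤ π⁻¹ j' := by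
      rcases hjj'.eq_or_lt with rfl | hlt
      · exact le_rfl
      · exact (hπ.lt _ _ (by simpa using hlt) (Or.inl (by simpa using hj'))).le
    refine ⟨?_, hj.2.trans_le hle⟩
    by_contra hcon
    have := hπ.lt (π⁻¹ j) i (by simpa using hj.1)
      (Or.inl (lt_of_le_of_lt (Fin.le_def.1 (not_lt.1 hcon)) hj'))
    exact absurd hj.2 this.not_gt

theorem isLeftJustification_rotheBPD (π : Equiv.Perm (Fin n)) :
    IsLeftJustification (rotheBPD π) (bottomPD π) := by
  intro i j
  rw [show (Finset.univ.filter fun m : Fin n => (rotheBPD π).tile i m = .blank).card =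
    lehmer π i from card_blank_rotheTile i]
  simp [bottomPD]

/-- The reflection of a topmost `jElbow` exhibits a cross-tile which is not left-justified. -/
theorem BPD.IsGood.eq_rotheBPD_of_isLeftJustified {D : BPD n} (hπ : IsSplit π k)
    (h : D.IsGood π k) (hl : (D.reflect k).IsLeftJustified) : D = rotheBPD π := by
  refine h.eq_rotheBPD hπ fun a b hab => ?_
  obtain ⟨i', j', hJ, hmin⟩ := exists_topmost_jElbow hab
  obtain ⟨i, j, hi, hj, e₁, e₂, -⟩ := h.topmost_jElbow hJ hmin
  have hj' := h.lt_of_jElbow hJ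
  have hk := hπ.le
  have h1 := (h.reflect_tile_eq_cross hπ (c := ⟨k - 1 - j, by omega⟩)
    (by simp only; omega)).2 e₁
  have h2 := hl i _ ⟨k - 1 - j', by omega⟩ (by rw [Fin.le_def]; simp only; omega) h1
  rw [h.reflect_tile_eq_cross hπ (j := j') (by simp only; omega)] at h2
  rcases e₂ with e | e <;> simp [e] at h2

theorem mem_slide_iff (hπ : IsSplit π k) {P : PD n} : P ∈ slide π ↔ P.IsGood π k := by
  have hR := BPD.rotheBPD_isGood hπ
  rw [slide, Set.mem_ofPred_eq, ← reflect_rotheBPD hπ, hR.reflect_le_iff hπ]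
  constructor
  · rintro ⟨D, hD, -, rfl⟩
    exact hD.isGood_reflect hπ
  · intro h
    obtain ⟨D, hD, e⟩ := h.exists_reflect_eq hπ
    exact ⟨D, hD, hD.rotheBPD_le hπ, e⟩

/-! ### The bijection -/

/-- The reflection as a bijection between `BPD(π)` and `PD^red(π)`. -/
noncomputable def reflectEquiv (hπ : IsSplit π k) : bpdSet π ≃ pdRedSet π :=
  Equiv.ofBijective
    (fun D => ⟨D.1.reflect k,
      (PD.mem_pdRedSet_iff hπ).2 (((mem_bpdSet_iff hπ).1 D.2).isGood_reflect hπ)⟩) <| by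
    constructor
    · intro D D' e
      exact Subtype.ext (((mem_bpdSet_iff hπ).1 D.2).eq_of_reflect_eq hπ
        ((mem_bpdSet_iff hπ).1 D'.2) (congrArg Subtype.val e))
    · rintro ⟨P, hP⟩
      obtain ⟨D, hD, e⟩ := ((PD.mem_pdRedSet_iff hπ).1 hP).exists_reflect_eq hπ
      exact ⟨⟨D, (mem_bpdSet_iff hπ).2 hD⟩, Subtype.ext e⟩

theorem reflectEquiv_coe (hπ : IsSplit π k) (D : bpdSet π) :
    (reflectEquiv hπ D).1 = D.1.reflect k := rfl

end PipeDreams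

theorem mainTheorem5 (n : ℕ) (π : Equiv.Perm (Fin n))
    (hπ : PipeDreams.IsInverseGrassmannian π) :
    PipeDreams.droop π = PipeDreams.bpdSet π ∧
    PipeDreams.slide π = PipeDreams.pdRedSet π ∧
    PipeDreams.rotheBPD π ∈ PipeDreams.bpdSet π ∧
    (PipeDreams.bottomPD π ∈ PipeDreams.pdRedSet π ∧
      ∀ P ∈ PipeDreams.pdRedSet π, P.IsLeftJustified → P = PipeDreams.bottomPD π) ∧
    ∃ Φ : PipeDreams.bpdSet π ≃ PipeDreams.pdRedSet π,
      -- the bijection is weight-preserving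
      (∀ D, (Φ D).1.weight = D.1.weight) ∧
      -- it restricts to an isomorphism of the posets generated by droops and by slides
      (∃ Ψ : PipeDreams.droop π ≃o PipeDreams.slide π,
        ∀ (D : PipeDreams.BPD n) (h : D ∈ PipeDreams.droop π) (h' : D ∈ PipeDreams.bpdSet π),
          (Ψ ⟨D, h⟩).1 = (Φ ⟨D, h'⟩).1) ∧
      -- simple droops correspond to simple slides
      (∀ D D', PipeDreams.BPD.DroopStep D.1 D'.1 ↔
        PipeDreams.PD.SlideStep (Φ D).1 (Φ D').1) ∧
      -- it sends the Rothe diagram to the bottom pipe dream by left-justification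
      (∀ h : PipeDreams.rotheBPD π ∈ PipeDreams.bpdSet π,
        (Φ ⟨PipeDreams.rotheBPD π, h⟩).1 = PipeDreams.bottomPD π) ∧
      PipeDreams.IsLeftJustification (PipeDreams.rotheBPD π) (PipeDreams.bottomPD π) ∧
      -- explicitly: it reflects the blank tiles of each row in the columns up to the descent
      (∀ c ∈ PipeDreams.descents π⁻¹, ∀ D, ∀ i j : Fin n,
        (Φ D).1.tile i j = PipeDreams.PTile.cross ↔
          ∃ k : Fin n, (j : ℕ) + k = c ∧ D.1.tile i k = PipeDreams.BTile.blank) := by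
  obtain ⟨k, hk, hkc⟩ := PipeDreams.exists_isSplit hπ
  have hdroop : PipeDreams.droop π = PipeDreams.bpdSet π := Set.ext fun D => by
    rw [PipeDreams.mem_droop_iff hk, PipeDreams.mem_bpdSet_iff hk]
  have hslide : PipeDreams.slide π = PipeDreams.pdRedSet π := Set.ext fun P => by
    rw [PipeDreams.mem_slide_iff hk, PipeDreams.PD.mem_pdRedSet_iff hk]
  have good : ∀ D : PipeDreams.bpdSet π, D.1.IsGood π k := fun D =>
    (PipeDreams.mem_bpdSet_iff hk).1 D.2
  have hR := PipeDreams.BPD.rotheBPD_isGood hk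
  have hB := PipeDreams.reflect_rotheBPD hk
  refine ⟨hdroop, hslide, (PipeDreams.mem_bpdSet_iff hk).2 hR, ⟨?_, ?_⟩,
    PipeDreams.reflectEquiv hk, ?_, ⟨?_, ?_⟩, ?_, ?_, PipeDreams.isLeftJustification_rotheBPD π, ?_⟩
  · rw [PipeDreams.PD.mem_pdRedSet_iff hk, ← hB]
    exact hR.isGood_reflect hk
  · intro P hP hl
    obtain ⟨D, hD, rfl⟩ := ((PipeDreams.PD.mem_pdRedSet_iff hk).1 hP).exists_reflect_eq hk
    rw [hD.eq_rotheBPD_of_isLeftJustified hk hl, hB]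
  · exact fun D => (good D).weight_reflect hk
  · exact
      { toEquiv := (Equiv.setCongr hdroop).trans
          ((PipeDreams.reflectEquiv hk).trans (Equiv.setCongr hslide.symm))
        map_rel_iff' := fun {D D'} => (good ⟨D.1, hdroop ▸ D.2⟩).reflect_le_reflect_iff hk
          (good ⟨D'.1, hdroop ▸ D'.2⟩) }
  · intro D h h'
    rfl
  · exact fun D D' => (good D).droopStep_iff hk (good D')
  · exact fun _ => hB
  · intro c hc D i j
    rw [PipeDreams.reflectEquiv_coe, (good D).reflect_tile_iff hk, hkc c hc]
    simp only [add_left_inj]
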